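/- Let $\beta>0$. Let $\mathcal E_\beta$ be the set of $C^1$ functions $\ell:[0,1]\to\mathbb R$ (differentiable up to the endpoints) such that $e^{\ell}$ is concave, $\ell(\tfrac12)=0$, and $|\ell'(x)-\ell'(y)|\le\beta|x-y|$ for all $x,y\in[0,1]$. For a partition $\mathcal P=\{0=x_1<x_2<\dots<x_d=1\}$ containing $\tfrac12$, put $\delta=\max_i(x_{i+1}-x_i)$ and $\underline\delta=\min_i(x_{i+1}-x_i)$. For a vector $\boldsymbol\ell\in\mathbb R^d$ let $\hat{\boldsymbol\ell}$ be the piecewise affine function on $[0,1]$ with $\hat{\boldsymbol\ell}(x_i)=\boldsymbol\ell_i$, and let $\Delta_i\boldsymbol\ell=\frac{\boldsymbol\ell_{i+1}-\boldsymbol\ell_i}{x_{i+1}-x_i}$ for $1\le i\le d-1$. The vector $\boldsymbol\ell$ is called feasible if (a) $-\boldsymbol\ell_i+\log\big(w_ie^{\boldsymbol\ell_{i+1}}+(1-w_i)e^{\boldsymbol\ell_{i-1}}\big)\le0$ with $w_i=\frac{x_i-x_{i-1}}{x_{i+1}-x_{i-1}}$, for $2\le i\le d-1$; (b) $-(\Delta_{i+1}\boldsymbol\ell-\Delta_i\boldsymbol\ell)-\frac\beta2(x_{i+2}-x_i)\le0$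 for $1\le i\le d-2$; (c) $(\Delta_1\boldsymbol\ell)^2\le\beta$ and $(\Delta_{d-1}\boldsymbol\ell)^2\le\beta$; (d) $\hat{\boldsymbol\ell}(\tfrac12)=0$. Let $f$ be the piecewise affine function on $[0,1]$ with $f(x_i)=e^{\boldsymbol\ell_i}$. Define $s_{\mathcal P}$ on $[0,1]$ by $$s_{\mathcal P}(x)=\tfrac{f(x_i)+f(x_i-\underline\delta)}2+\tfrac{f(x_i)-f(x_i-\underline\delta)}{\underline\delta}\Big(x-x_i+\tfrac{\underline\delta}2\Big)+\tfrac{f(x_i+\underline\delta)-2f(x_i)+f(x_i-\underline\delta)}{2\underline\delta^2}\Big(x-x_i+\tfrac{\underline\delta}2\Big)^2$$ for $|x-x_i|\le\underline\delta/2$, $2\le i\le d-1$, and $s_{\mathcal P}(x)=f(x)$ at all other points $x$. For $0<\alpha<1$ put $$\ell_{\alpha,\mathcal P}(x)=\log\big(s_{\mathcal P}(x)+\underline\delta^\alpha\big)-\log\big(s_{\mathcal P}(\tfrac12)+\underline\delta^\alpha\big).$$ **Proposition.** Let $\beta>0$ and $M>0$. There is a constant $K>0$, depending only on $\beta$ and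 $M$, such that for every $0<\alpha<1$ there is a $\delta_{0,\alpha}>0$, depending only on $\alpha$, $\beta$ and $M$, with the following property. For every partition $\mathcal P$ containing $\tfrac12$ with $|\delta-\underline\delta|\le M\underline\delta^3$ and $\underline\delta<\delta_{0,\alpha}$, and for every feasible $\boldsymbol\ell\in\mathbb R^d$, the function $s_{\mathcal P}$ is positive and $C^1$ on $[0,1]$, $\ell_{\alpha,\mathcal P}\in\mathcal E_\beta$, and $$|\ell_{\alpha,\mathcal P}'(x)-\hat{\boldsymbol\ell}'(x)|\le K\underline\delta^\alpha\le K\delta^\alpha\qquad\text{for all }x\in[0,1],$$ where at a node $\hat{\boldsymbol\ell}'(x)$ may be either one-sided derivative (the right one at $0$, the left one at $1$). -/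

import Mathlib

open Set

noncomputable section

/-- The class of generating functions: continuously differentiable on `[0,1]` (up to the
endpoints), exponentially concave, vanishing at `1/2`. Only the values on `[0,1]` matter. -/
def GenFun : Set (ℝ → ℝ) :=
  {l | ContDiffOn ℝ 1 l (Icc 0 1) ∧ ConcaveOn ℝ (Icc 0 1) (fun x => Real.exp (l x)) ∧
    l (1 / 2) = 0}

/-- The members of `GenFun` whose derivative is Lipschitz on `[0,1]` with constant `β`. -/
def GenFunSmooth (β : ℝ) : Set (ℝ → ℝ) :=
  {l | l ∈ GenFun ∧ ∀ x ∈ Icc (0 : ℝ) 1, ∀ y ∈ Icc (0 : ℝ) 1,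
    |derivWithin l (Icc 0 1) x - derivWithin l (Icc 0 1) y| ≤ β * |x - y|}

/-- A partition of `[0,1]` into `N` intervals, having `1/2` among its `N + 1` nodes. -/
structure UnitPartition (N : ℕ) where
  node : Fin (N + 1) → ℝ
  strictMono : StrictMono node
  node_zero : node 0 = 0
  node_last : node (Fin.last N) = 1
  half_mem : ∃ i, node i = 1 / 2

namespace UnitPartition

variable {N : ℕ} (P : UnitPartition N)

/-- The length of the `i`-th interval `[node i.castSucc, node i.succ]`. -/
def gap (i : Fin N) : ℝ := P.node i.succ - P.node i.castSucc

/-- The mesh size, the largest length of an interval. -/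
def mesh : ℝ := ⨆ i, P.gap i

/-- The minimal mesh size, the smallest length of an interval. -/
def minMesh : ℝ := ⨅ i, P.gap i

/-- The difference quotient of the nodal values `v` over the `i`-th interval. -/
def slope (v : Fin (N + 1) → ℝ) (i : Fin N) : ℝ :=
  (v i.succ - v i.castSucc) / P.gap i

open Classical in
/-- The piecewise affine function on `[0,1]` with the nodal values `v` (and `0` off `[0,1]`). -/
def interp (v : Fin (N + 1) → ℝ) (x : ℝ) : ℝ :=
  if h : ∃ i : Fin N, x ∈ Icc (P.node i.castSucc) (P.node i.succ) then
    v h.choose.castSucc + P.slope v h.choose * (x - P.node h.choose.castSucc)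
  else 0

/-- The constraints of the discretized problem on the nodal values `l`. Consecutive intervals are
written as `i`, `j` with `j = i + 1`; they meet at the node `i.succ = j.castSucc`. -/
structure Feasible (β : ℝ) (l : Fin (N + 1) → ℝ) : Prop where
  expConcave : ∀ i j : Fin N, (j : ℕ) = i + 1 →
    -l i.succ + Real.log
      ((P.node i.succ - P.node i.castSucc) / (P.node j.succ - P.node i.castSucc)
          * Real.exp (l j.succ)
        + (1 - (P.node i.succ - P.node i.castSucc) / (P.node j.succ - P.node i.castSucc))
          * Real.exp (l i.castSucc)) ≤ 0
  smooth : ∀ i j : Fin N, (j : ℕ) = i + 1 →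
    -(P.slope l j - P.slope l i) - β / 2 * (P.node j.succ - P.node i.castSucc) ≤ 0
  left_end : ∀ i : Fin N, (i : ℕ) = 0 → P.slope l i ^ 2 - β ≤ 0
  right_end : ∀ i : Fin N, (i : ℕ) + 1 = N → P.slope l i ^ 2 - β ≤ 0
  half : P.interp l (1 / 2) = 0

/-- The piecewise affine interpolant of the exponentials of the nodal values `l`. -/
def expInterp (l : Fin (N + 1) → ℝ) : ℝ → ℝ := P.interp (fun i => Real.exp (l i))

/-- The quadratic that replaces `P.expInterp l` within `minMesh / 2` of the interior node `i`. -/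
def quad (l : Fin (N + 1) → ℝ) (i : Fin (N + 1)) (x : ℝ) : ℝ :=
  let f := P.expInterp l
  let xi := P.node i
  let δ := P.minMesh
  (f xi + f (xi - δ)) / 2
    + (f xi - f (xi - δ)) / δ * (x - ((xi - δ) + xi) / 2)
    + (f (xi + δ) - 2 * f xi + f (xi - δ)) / (2 * δ ^ 2) * (x - ((xi - δ) + xi) / 2) ^ 2

/-- `x` lies in the interval of length `minMesh` centred at the interior node `i`. -/
def NearInterior (i : Fin (N + 1)) (x : ℝ) : Prop :=
  i ≠ 0 ∧ i ≠ Fin.last N ∧ x ∈ Icc (P.node i - P.minMesh / 2) (P.node i + P.minMesh / 2)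

open Classical in
/-- The piecewise quadratic smoothing of `P.expInterp l`. -/
def smoothing (l : Fin (N + 1) → ℝ) (x : ℝ) : ℝ :=
  if h : ∃ i, P.NearInterior i x then P.quad l h.choose x else P.expInterp l x

/-- `log (smoothing + minMesh ^ α)` plus the constant that makes it vanish at `1/2`. -/
def logSmoothing (α : ℝ) (l : Fin (N + 1) → ℝ) (x : ℝ) : ℝ :=
  Real.log (P.smoothing l x + P.minMesh ^ α)
    - Real.log (P.smoothing l (1 / 2) + P.minMesh ^ α)

/-- The gaps are positive. -/
theorem gap_pos (i : Fin N) : 0 < P.gap i :=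
  sub_pos.2 (P.strictMono i.castSucc_lt_succ)

/-- The value of the interpolant does not depend on the interval that is picked at a node. -/
theorem interp_eq (v : Fin (N + 1) → ℝ) (i : Fin N) {x : ℝ}
    (hx : x ∈ Icc (P.node i.castSucc) (P.node i.succ)) :
    P.interp v x = v i.castSucc + P.slope v i * (x - P.node i.castSucc) := by
  have key : ∀ i j : Fin N, i < j → x ∈ Icc (P.node i.castSucc) (P.node i.succ) →
      x ∈ Icc (P.node j.castSucc) (P.node j.succ) →
      v i.castSucc + P.slope v i * (x - P.node i.castSucc)
        = v j.castSucc + P.slope v j * (x - P.node j.castSucc) := by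
    intro i j hij hi hj
    have h1 : i.succ ≤ j.castSucc := by
      rw [Fin.le_def]; simp only [Fin.val_succ, Fin.val_castSucc]; exact hij
    have h2 := P.strictMono.monotone h1
    have h3 : P.node i.succ = P.node j.castSucc := le_antisymm h2 (hj.1.trans hi.2)
    have h4 : i.succ = j.castSucc := P.strictMono.injective h3
    have hxe : x = P.node i.succ := le_antisymm hi.2 (h3 ▸ hj.1)
    rw [← h4, hxe, sub_self, mul_zero, add_zero]
    have h5 := (P.gap_pos i).ne'
    change v i.castSucc + (v i.succ - v i.castSucc) / P.gap i * P.gap i = _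
    field_simp
    ring
  have hex : ∃ i : Fin N, x ∈ Icc (P.node i.castSucc) (P.node i.succ) := ⟨i, hx⟩
  rw [interp, dif_pos hex]
  rcases lt_trichotomy hex.choose i with h | h | h
  · exact key _ _ h hex.choose_spec hx
  · rw [h]
  · exact (key _ _ h hx hex.choose_spec).symm

end UnitPartition

end

/-!
The quadratics in the definition of the smoothing are such that, on `[0,1]`, the smoothing is the
moving average, over windows of length `d = minMesh`, of the piecewise affine interpolant `f` of the
nodal exponentials, extended affinely beyond `0` and `1`
(`UnitPartition.smoothing_eq_movingAverage`). The exponential concavity constraint makes `f` concave,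
and its concave extension is the lower envelope of the lines through consecutive nodal values
(`UnitPartition.envelope`). Hence the smoothing `s` is concave and `C¹`, with derivative
`s' x = (f (x + d / 2) - f (x - d / 2)) / d`, which lies between the two slopes of `f` that the
window meets (`UnitPartition.windowSlope_mem`).

With `ε = d ^ α`, the derivative of the logarithm is `G = s' / (s + ε)`, and its right derivative is
`s'' / (s + ε) - G ^ 2`, where `s''` is the difference of the two slopes divided by `d`. It is
nonpositive by concavity. If the window contains no node, then `s'' = 0`, and `G ^ 2 ≤ β` because `G`
is antitone and the constraints on the first and last slope bound it at `0` and `1`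
(`UnitPartition.Feasible.abs_logSlope_le`). If it contains one, a second order expansion of the
slopes of `f` and the smoothness constraint give, in units of the nodal value,
`s'' ≥ s' ^ 2 - β - O(d)`, so that the right derivative is at least `-β` as soon as `s + ε` exceeds
the nodal value by a large multiple of `d` (`curvature_lower_bound`). As `d = o(d ^ α)`, this holds
on fine partitions. Hence `G` is Lipschitz with the exact constant `β`.

Finally `s`, `s'` differ by `O(d)` from the nodal values and slopes of `f`, and adding `ε` changes
`G` by `O(ε)`, so that `G` is within `O(ε)` of the slopes of the interpolant of `l`
(`UnitPartition.Feasible.abs_logSlope_sub_slope_le`).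
-/

/-! ### Elementary estimates -/

theorem sub_abs_cube_le_exp_sub_one {u : ℝ} (hu : |u| ≤ 1) :
    u + u ^ 2 / 2 - |u| ^ 3 ≤ Real.exp u - 1 := by
  have h := Real.exp_bound hu (n := 3) (by norm_num)
  simp only [Finset.sum_range_succ, Finset.sum_range_zero] at h
  norm_num [Nat.factorial] at h
  have h2 := (abs_le.1 h).1
  have h3 : 0 ≤ |u| ^ 3 := by positivity
  linarith

/-- The difference quotient of `exp ∘ l` against the one of `l`, to second order, at the left end. -/
theorem exp_slope_left {a b g B : ℝ} (hg : 0 < g) (hB : |(b - a) / g| ≤ B) (hBg : B * g ≤ 1) :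
    |(Real.exp b - Real.exp a) / g - Real.exp a * ((b - a) / g)| ≤ Real.exp a * (B ^ 2 * g) ∧
    Real.exp a * ((b - a) / g + ((b - a) / g) ^ 2 * g / 2 - B ^ 3 * g ^ 2)
      ≤ (Real.exp b - Real.exp a) / g := by
  set D := (b - a) / g with hD
  have hu : b - a = D * g := by rw [hD]; field_simp
  have hb : Real.exp b = Real.exp a * Real.exp (D * g) := by
    rw [← Real.exp_add, ← hu]; ring_nf
  have habs : |D * g| ≤ B * g := by
    rw [abs_mul, abs_of_pos hg]; gcongr
  have hsplit : (Real.exp b - Real.exp a) / g = Real.exp a * ((Real.exp (D * g) - 1) / g) := by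
    rw [hb]; ring
  have hE := Real.exp_pos a
  rw [hsplit]
  constructor
  · rw [← mul_sub, abs_mul, abs_of_pos hE]
    gcongr
    have h := Real.abs_exp_sub_one_sub_id_le (habs.trans hBg)
    have e : (Real.exp (D * g) - 1) / g - D = (Real.exp (D * g) - 1 - D * g) / g := by
      field_simp
    rw [e, abs_div, abs_of_pos hg, div_le_iff₀ hg]
    refine h.trans ?_
    have : (D * g) ^ 2 ≤ (B * g) ^ 2 := sq_le_sq' (by linarith [(abs_le.1 habs).1]) (abs_le.1 habs).2
    linarith
  · gcongr
    rw [le_div_iff₀ hg]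
    have h := sub_abs_cube_le_exp_sub_one (habs.trans hBg)
    have : |D * g| ^ 3 ≤ (B * g) ^ 3 := by gcongr
    linarith

/-- The same at the right end, by reflection. -/
theorem exp_slope_right {a b g B : ℝ} (hg : 0 < g) (hB : |(b - a) / g| ≤ B) (hBg : B * g ≤ 1) :
    |(Real.exp b - Real.exp a) / g - Real.exp b * ((b - a) / g)| ≤ Real.exp b * (B ^ 2 * g) ∧
    (Real.exp b - Real.exp a) / g
      ≤ Real.exp b * ((b - a) / g - ((b - a) / g) ^ 2 * g / 2 + B ^ 3 * g ^ 2) := by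
  have e : (a - b) / g = -((b - a) / g) := by ring
  have h := exp_slope_left (a := b) (b := a) hg (B := B) (by rwa [e, abs_neg]) hBg
  have e2 : (Real.exp a - Real.exp b) / g = -((Real.exp b - Real.exp a) / g) := by ring
  rw [e, e2] at h
  refine ⟨?_, by linarith [h.2]⟩
  rw [← abs_neg]
  refine le_trans (le_of_eq ?_) h.1
  congr 1; ring

/-- A constant multiple of `d` is dominated by `d ^ α` for small `d`. -/
theorem exists_forall_mul_le_rpow (A : ℝ) {α : ℝ} (hα : α < 1) :
    ∃ d₀ : ℝ, 0 < d₀ ∧ ∀ d : ℝ, 0 < d → d < d₀ → A * d ≤ d ^ α := by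
  have hA : 0 < |A| + 1 := by positivity
  refine ⟨(1 / (|A| + 1)) ^ (1 / (1 - α)), by positivity, fun d hd hlt => ?_⟩
  have h1 : 0 < 1 - α := by linarith
  have h2 : d ^ (1 - α) ≤ 1 / (|A| + 1) := by
    have := Real.rpow_le_rpow hd.le hlt.le h1.le
    rwa [← Real.rpow_mul (by positivity), one_div_mul_cancel h1.ne', Real.rpow_one] at this
  have h3 : d = d ^ (1 - α) * d ^ α := by
    rw [← Real.rpow_add hd]; simp
  have h4 : 0 < d ^ α := Real.rpow_pos_of_pos hd α
  have h5 : A * d ^ (1 - α) ≤ 1 := by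
    have : A * d ^ (1 - α) ≤ (|A| + 1) * (1 / (|A| + 1)) := by
      gcongr
      linarith [le_abs_self A]
    rwa [mul_one_div_cancel hA.ne'] at this
  calc A * d = (A * d ^ (1 - α)) * d ^ α := by rw [mul_assoc, ← h3]
    _ ≤ 1 * d ^ α := by gcongr
    _ = d ^ α := one_mul _

theorem Fin.monotone_of_le_next {N : ℕ} {g : Fin N → ℝ}
    (h : ∀ i j : Fin N, (j : ℕ) = i + 1 → g i ≤ g j) : Monotone g := by
  cases N with
  | zero => exact fun i => i.elim0
  | succ n => exact Fin.monotone_iff_le_succ.2 fun i => h _ _ (by simp)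

/-! ### Moving averages -/

/-- The average of `f` over the interval of length `d` centred at `x`. -/
noncomputable def movingAverage (f : ℝ → ℝ) (d x : ℝ) : ℝ :=
  (∫ t in (x - d / 2)..(x + d / 2), f t) / d

theorem hasDerivAt_movingAverage {f : ℝ → ℝ} (hf : Continuous f) (d x : ℝ) :
    HasDerivAt (movingAverage f d) ((f (x + d / 2) - f (x - d / 2)) / d) x := by
  have hF : ∀ y, HasDerivAt (fun u => ∫ t in (0 : ℝ)..u, f t) (f y) y := fun y =>
    intervalIntegral.integral_hasDerivAt_right (hf.intervalIntegrable _ _)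
      hf.aestronglyMeasurable.stronglyMeasurableAtFilter hf.continuousAt
  have e : movingAverage f d = fun x =>
      ((∫ t in (0 : ℝ)..(x + d / 2), f t) - ∫ t in (0 : ℝ)..(x - d / 2), f t) / d := by
    funext y
    rw [movingAverage, intervalIntegral.integral_interval_sub_left] <;>
      exact hf.intervalIntegrable _ _
  rw [e]
  have h1 := (hF (x + d / 2)).comp_add_const x (d / 2)
  have h2 := (hF (x - d / 2)).comp_sub_const x (d / 2)
  exact (h1.sub h2).div_const d

theorem contDiff_movingAverage {f : ℝ → ℝ} (hf : Continuous f) (d : ℝ) :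
    ContDiff ℝ 1 (movingAverage f d) := by
  rw [contDiff_one_iff_deriv]
  refine ⟨fun x => (hasDerivAt_movingAverage hf d x).differentiableAt, ?_⟩
  have : deriv (movingAverage f d) = fun x => (f (x + d / 2) - f (x - d / 2)) / d :=
    funext fun x => (hasDerivAt_movingAverage hf d x).deriv
  rw [this]
  fun_prop

theorem abs_movingAverage_sub_le_of_forall {f : ℝ → ℝ} (hf : Continuous f) {d : ℝ}
    (hd : 0 < d) {x c E : ℝ}
    (h : ∀ t ∈ Icc (x - d / 2) (x + d / 2), |f t - c| ≤ E) :
    |movingAverage f d x - c| ≤ E := by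
  have e : movingAverage f d x - c = (∫ t in (x - d / 2)..(x + d / 2), (f t - c)) / d := by
    rw [intervalIntegral.integral_sub (hf.intervalIntegrable _ _) (by simp), movingAverage]
    simp only [intervalIntegral.integral_const, smul_eq_mul]
    field_simp
    ring
  rw [e, abs_div, abs_of_pos hd, div_le_iff₀ hd]
  have := intervalIntegral.norm_integral_le_of_norm_le_const
    (a := x - d / 2) (b := x + d / 2) (C := E) (f := fun t => f t - c) (by
      intro t ht
      rw [uIoc_of_le (by linarith)] at ht
      exact h t ⟨ht.1.le, ht.2⟩)
  rw [show x + d / 2 - (x - d / 2) = d by ring, abs_of_pos hd] at this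
  exact this

theorem integral_affine (v F c a b : ℝ) :
    ∫ t in a..b, (v + F * (t - c)) = v * (b - a) + F * ((b - c) ^ 2 - (a - c) ^ 2) / 2 := by
  have h : ∀ t ∈ uIcc a b, HasDerivAt (fun t => v * t + F * (t - c) ^ 2 / 2)
      (v + F * (t - c)) t := by
    intro t _
    have h1 := ((hasDerivAt_id t).const_mul v).add
      (((((hasDerivAt_id t).sub_const c).pow 2).const_mul F).div_const 2)
    refine h1.congr_deriv ?_
    simp; ring
  rw [intervalIntegral.integral_eq_sub_of_hasDerivAt h
    (Continuous.intervalIntegrable (by fun_prop) _ _)]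
  ring

/-! ### Right derivatives -/

theorem antitoneOn_of_deriv_right_nonpos {g g' : ℝ → ℝ} {a b : ℝ} (hg : ContinuousOn g (Icc a b))
    (hd : ∀ x ∈ Ico a b, HasDerivWithinAt g (g' x) (Ici x) x) (h : ∀ x ∈ Ico a b, g' x ≤ 0) :
    AntitoneOn g (Icc a b) := by
  intro x hx y hy hxy
  refine image_le_of_deriv_right_le_deriv_boundary (a := x) (b := y) (f := g) (f' := g')
    (B := fun _ => g x) (B' := fun _ => 0) (hg.mono (Icc_subset_Icc hx.1 hy.2))
    (fun z hz => hd z ⟨hx.1.trans hz.1, hz.2.trans_le hy.2⟩) le_rfl continuousOn_const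
    (fun z _ => hasDerivWithinAt_const _ _ _)
    (fun z hz => h z ⟨hx.1.trans hz.1, hz.2.trans_le hy.2⟩) ⟨hxy, le_rfl⟩

theorem abs_sub_le_of_deriv_right {g g' : ℝ → ℝ} {a b C : ℝ} (hg : ContinuousOn g (Icc a b))
    (hd : ∀ x ∈ Ico a b, HasDerivWithinAt g (g' x) (Ici x) x) (h : ∀ x ∈ Ico a b, |g' x| ≤ C)
    {x y : ℝ} (hx : x ∈ Icc a b) (hy : y ∈ Icc a b) : |g x - g y| ≤ C * |x - y| := by
  wlog hxy : x ≤ y generalizing x y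
  · rw [abs_sub_comm, abs_sub_comm x]
    exact this hy hx (le_of_not_ge hxy)
  rw [abs_sub_comm, abs_sub_comm x, abs_of_nonneg (sub_nonneg.2 hxy)]
  exact norm_image_sub_le_of_norm_deriv_right_le_segment (hg.mono (Icc_subset_Icc hx.1 hy.2))
    (fun z hz => hd z ⟨hx.1.trans hz.1, hz.2.trans_le hy.2⟩)
    (fun z hz => h z ⟨hx.1.trans hz.1, hz.2.trans_le hy.2⟩) y ⟨hxy, le_rfl⟩

namespace UnitPartition

variable {N : ℕ} (P : UnitPartition N)

/-! ### Gaps and cells of a partition -/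

theorem two_le (P : UnitPartition N) : 2 ≤ N := by
  by_contra h
  have h2 : N = 0 ∨ N = 1 := by omega
  have h0 := P.node_zero
  have h1 := P.node_last
  obtain ⟨i, hi⟩ := P.half_mem
  rcases h2 with rfl | rfl
  · have : P.node 0 = 1 := h1
    linarith
  · fin_cases i
    · have : P.node 0 = 1 / 2 := hi
      linarith
    · have : P.node 1 = 1 / 2 := hi
      have h1' : P.node 1 = 1 := h1
      linarith

theorem pos (P : UnitPartition N) : 0 < N := lt_of_lt_of_le two_pos P.two_le

theorem minMesh_le_gap (i : Fin N) : P.minMesh ≤ P.gap i := ciInf_le (finite_range _).bddBelow i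

theorem gap_le_mesh (i : Fin N) : P.gap i ≤ P.mesh := le_ciSup (finite_range _).bddAbove i

theorem minMesh_pos : 0 < P.minMesh := by
  have : Nonempty (Fin N) := ⟨⟨0, P.pos⟩⟩
  obtain ⟨i, hi⟩ := exists_eq_ciInf_of_finite (f := P.gap)
  rw [minMesh, ← hi]
  exact P.gap_pos i

theorem minMesh_le_mesh : P.minMesh ≤ P.mesh :=
  (P.minMesh_le_gap ⟨0, P.pos⟩).trans (P.gap_le_mesh _)

theorem castSucc_eq_succ {i j : Fin N} (h : (j : ℕ) = i + 1) : j.castSucc = i.succ :=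
  Fin.ext (by simpa using h)

theorem node_castSucc_of_val_zero {i : Fin N} (h : (i : ℕ) = 0) : P.node i.castSucc = 0 := by
  rw [← P.node_zero]; congr 1; exact Fin.ext (by simpa using h)

theorem node_succ_of_val_last {i : Fin N} (h : (i : ℕ) + 1 = N) : P.node i.succ = 1 := by
  rw [← P.node_last]; congr 1; exact Fin.ext (by simpa using h)

theorem node_mem (i : Fin (N + 1)) : P.node i ∈ Icc (0 : ℝ) 1 := by
  rw [← P.node_zero, ← P.node_last]
  exact ⟨P.strictMono.monotone (Fin.zero_le i), P.strictMono.monotone (Fin.le_last i)⟩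

theorem node_succ_le_castSucc {i j : Fin N} (h : i < j) : P.node i.succ ≤ P.node j.castSucc := by
  apply P.strictMono.monotone
  rw [Fin.le_def]; simpa using h

/-- `y` lies in the `i`-th closed interval, where the first and the last interval are extended to
`-∞` and to `∞`. -/
def InCell (i : Fin N) (y : ℝ) : Prop :=
  ((i : ℕ) = 0 ∨ P.node i.castSucc ≤ y) ∧ ((i : ℕ) + 1 = N ∨ y ≤ P.node i.succ)

/-- The variant of `InCell` for intervals that contain their left end only. -/
def InRightCell (i : Fin N) (y : ℝ) : Prop :=
  ((i : ℕ) = 0 ∨ P.node i.castSucc ≤ y) ∧ ((i : ℕ) + 1 = N ∨ y < P.node i.succ)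

variable {P} in
theorem InRightCell.inCell {i : Fin N} {y : ℝ} (h : P.InRightCell i y) : P.InCell i y :=
  ⟨h.1, h.2.imp_right le_of_lt⟩

theorem exists_inRightCell (y : ℝ) : ∃ i, P.InRightCell i y := by
  classical
  let S : Finset (Fin N) := {i | (i : ℕ) = 0 ∨ P.node i.castSucc ≤ y}
  have hS : S.Nonempty := ⟨⟨0, P.pos⟩, by simp [S]⟩
  refine ⟨S.max' hS, ?_, ?_⟩
  · have := S.max'_mem hS
    simpa [S] using this
  · by_contra! h
    obtain ⟨h1, h2⟩ := h
    have hlt : (S.max' hS : ℕ) + 1 < N := by have := (S.max' hS).isLt; omega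
    have hmem : (⟨(S.max' hS : ℕ) + 1, hlt⟩ : Fin N) ∈ S := by
      simp only [S, Finset.mem_filter, Finset.mem_univ, true_and]
      right
      exact (congrArg P.node (castSucc_eq_succ rfl)).trans_le h2
    have := S.le_max' _ hmem
    rw [Fin.le_def] at this
    simp at this

variable {P} in
theorem InRightCell.eventually {i : Fin N} {y : ℝ} (h : P.InRightCell i y) :
    ∀ᶠ t in nhdsWithin y (Ici y), P.InCell i t := by
  rcases h.2 with h2 | h2
  · filter_upwards [self_mem_nhdsWithin] with t ht
    exact ⟨h.1.imp_right fun h => h.trans ht, Or.inl h2⟩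
  · filter_upwards [self_mem_nhdsWithin, mem_nhdsWithin_of_mem_nhds (Iio_mem_nhds h2)] with t ht ht2
    exact ⟨h.1.imp_right fun h => h.trans ht, Or.inr (le_of_lt ht2)⟩

/-- A window of length `minMesh` meets at most two consecutive cells. -/
theorem cells_of_window {x : ℝ} {i j : Fin N} (hi : P.InRightCell i (x - P.minMesh / 2))
    (hj : P.InRightCell j (x + P.minMesh / 2)) :
    i = j ∨ (j : ℕ) = i + 1 ∧
      P.node i.succ ∈ Icc (x - P.minMesh / 2) (x + P.minMesh / 2) := by
  have hd := P.minMesh_pos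
  rcases lt_trichotomy i j with h | h | h
  · right
    have hi2 : x - P.minMesh / 2 < P.node i.succ := by
      rcases hi.2 with h2 | h2
      · have := j.isLt; rw [Fin.lt_def] at h; omega
      · exact h2
    have hj1 : P.node j.castSucc ≤ x + P.minMesh / 2 := by
      rcases hj.1 with h2 | h2
      · rw [Fin.lt_def] at h; omega
      · exact h2
    have hji : (j : ℕ) = i + 1 := by
      by_contra hne
      have hlt : (i : ℕ) + 1 < j := by rw [Fin.lt_def] at h; omega
      let k : Fin N := ⟨i + 1, hlt.trans j.isLt⟩
      have h3 : P.node k.succ ≤ P.node j.castSucc := P.node_succ_le_castSucc hlt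
      have h4 := P.minMesh_le_gap k
      have h5 : k.castSucc = i.succ := castSucc_eq_succ rfl
      rw [gap, h5] at h4
      linarith
    refine ⟨hji, hi2.le, ?_⟩
    rwa [castSucc_eq_succ hji] at hj1
  · exact Or.inl h
  · exfalso
    have h1 := P.node_succ_le_castSucc h
    rcases hi.1 with h2 | h2
    · rw [Fin.lt_def] at h; omega
    rcases hj.2 with h3 | h3
    · have := i.isLt; rw [Fin.lt_def] at h; omega
    linarith

/-! ### The concave extension of an interpolant -/

/-- The affine function that agrees with the interpolant of `v` on the `i`-th interval. -/
noncomputable def line (v : Fin (N + 1) → ℝ) (i : Fin N) (x : ℝ) : ℝ :=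
  v i.castSucc + P.slope v i * (x - P.node i.castSucc)

/-- The lower envelope of the lines through consecutive nodal values. If the slopes decrease it
extends the interpolant of `v` to the whole line, with the first and the last slope outside
`[0,1]`. -/
noncomputable def envelope (v : Fin (N + 1) → ℝ) (x : ℝ) : ℝ := ⨅ i, P.line v i x

variable {v : Fin (N + 1) → ℝ}

theorem slope_mul_gap (v : Fin (N + 1) → ℝ) (i : Fin N) :
    P.slope v i * P.gap i = v i.succ - v i.castSucc := by
  rw [slope, div_mul_cancel₀ _ (P.gap_pos i).ne']

theorem line_eq_right (v : Fin (N + 1) → ℝ) (i : Fin N) (x : ℝ) :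
    P.line v i x = v i.succ + P.slope v i * (x - P.node i.succ) := by
  have h := P.slope_mul_gap v i
  rw [gap] at h
  rw [line]
  linarith

theorem hasDerivAt_line (v : Fin (N + 1) → ℝ) (i : Fin N) (x : ℝ) :
    HasDerivAt (P.line v i) (P.slope v i) x := by
  have := (((hasDerivAt_id x).sub_const (P.node i.castSucc)).const_mul
    (P.slope v i)).const_add (v i.castSucc)
  rw [mul_one] at this
  exact this

theorem line_next (v : Fin (N + 1) → ℝ) {i j : Fin N} (h : (j : ℕ) = i + 1) (x : ℝ) :
    P.line v j x = v i.succ + P.slope v j * (x - P.node i.succ) := by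
  rw [line, castSucc_eq_succ h]

/-- Two consecutive lines cross at their common node, so that in the `i`-th cell the lines increase
with their distance from the `i`-th one. -/
theorem line_le_line (hv : Antitone (P.slope v)) {i : Fin N} {y : ℝ} (hy : P.InCell i y)
    (j : Fin N) : P.line v i y ≤ P.line v j y := by
  rcases le_total i j with h | h
  · have key : ∀ n : ℕ, ∀ j : Fin N, (j : ℕ) = i + n → P.line v i y ≤ P.line v j y := by
      intro n
      induction n with
      | zero => intro j hj; rw [Fin.ext (a := j) (b := i) (by simpa using hj)]
      | succ n ih =>
        intro j hj
        have hk : (i : ℕ) + n < N := by have := j.isLt; omega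
        let k : Fin N := ⟨i + n, hk⟩
        have hjk : (j : ℕ) = k + 1 := by simp [k]; omega
        refine (ih k rfl).trans ?_
        rw [P.line_eq_right v k, P.line_next v hjk]
        have h1 : P.slope v j ≤ P.slope v k := hv (by rw [Fin.le_def]; omega)
        have h2 : y ≤ P.node k.succ := by
          rcases hy.2 with h2 | h2
          · have := j.isLt; omega
          · refine h2.trans (P.strictMono.monotone ?_)
            rw [Fin.le_def]; simp [k]
        nlinarith
    exact key (j - i) j (by rw [Fin.le_def] at h; omega)
  · have key : ∀ n : ℕ, ∀ j : Fin N, (i : ℕ) = j + n → P.line v i y ≤ P.line v j y := by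
      intro n
      induction n with
      | zero => intro j hj; rw [Fin.ext (a := i) (b := j) (by simpa using hj)]
      | succ n ih =>
        intro j hj
        have hk : (j : ℕ) + 1 < N := by have := i.isLt; omega
        let k : Fin N := ⟨j + 1, hk⟩
        have hjk : (k : ℕ) = j + 1 := rfl
        refine (ih k (by omega)).trans ?_
        rw [P.line_eq_right v j, P.line_next v hjk]
        have h1 : P.slope v k ≤ P.slope v j := hv (by rw [Fin.le_def]; omega)
        have h2 : P.node j.succ ≤ y := by
          rcases hy.1 with h2 | h2
          · omega
          · exact (P.node_succ_le_castSucc (by rw [Fin.lt_def]; omega)).trans h2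
        nlinarith
    exact key (i - j) j (by rw [Fin.le_def] at h; omega)

theorem envelope_eq_line (hv : Antitone (P.slope v)) {i : Fin N} {y : ℝ} (hy : P.InCell i y) :
    P.envelope v y = P.line v i y := by
  have : Nonempty (Fin N) := ⟨i⟩
  exact le_antisymm (ciInf_le (finite_range _).bddBelow i) (le_ciInf (P.line_le_line hv hy))

theorem abs_envelope_sub_le {L : ℝ} (hL : ∀ i, |P.slope v i| ≤ L) (x y : ℝ) :
    |P.envelope v x - P.envelope v y| ≤ L * |x - y| := by
  have : Nonempty (Fin N) := ⟨⟨0, P.pos⟩⟩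
  have key : ∀ x y, P.envelope v x ≤ P.envelope v y + L * |x - y| := by
    intro x y
    rw [← sub_le_iff_le_add]
    refine le_ciInf fun i => ?_
    rw [sub_le_iff_le_add]
    refine (ciInf_le (finite_range _).bddBelow i).trans ?_
    have h : P.slope v i * (x - y) ≤ L * |x - y| :=
      (le_abs_self _).trans (by rw [abs_mul]; gcongr; exact hL i)
    rw [line, line]
    linarith
  rw [abs_le]
  have h1 := key x y
  have h2 := key y x
  rw [abs_sub_comm] at h2
  constructor <;> linarith

theorem continuous_envelope (v : Fin (N + 1) → ℝ) : Continuous (P.envelope v) := by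
  have hL : ∀ i, |P.slope v i| ≤ ⨆ i, |P.slope v i| := fun i =>
    le_ciSup (f := fun i => |P.slope v i|) (finite_range _).bddAbove i
  have h0 : 0 ≤ ⨆ i, |P.slope v i| := (abs_nonneg _).trans (hL ⟨0, P.pos⟩)
  refine (LipschitzWith.of_dist_le_mul (K := ⟨_, h0⟩) fun x y => ?_).continuous
  exact P.abs_envelope_sub_le hL x y

theorem interp_eq_line (v : Fin (N + 1) → ℝ) {i : Fin N} {x : ℝ} (hx : x ∈ Icc (0 : ℝ) 1)
    (h : P.InCell i x) : P.interp v x = P.line v i x := by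
  refine P.interp_eq v i ⟨?_, ?_⟩
  · rcases h.1 with h | h
    · rw [P.node_castSucc_of_val_zero h]; exact hx.1
    · exact h
  · rcases h.2 with h | h
    · rw [P.node_succ_of_val_last h]; exact hx.2
    · exact h

theorem envelope_node_succ (hv : Antitone (P.slope v)) (i : Fin N) :
    P.envelope v (P.node i.succ) = v i.succ := by
  rw [P.envelope_eq_line hv (i := i), line_eq_right, sub_self, mul_zero, add_zero]
  exact ⟨Or.inr (P.strictMono.monotone (Fin.castSucc_lt_succ).le), Or.inr le_rfl⟩

theorem envelope_node_castSucc (hv : Antitone (P.slope v)) (i : Fin N) :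
    P.envelope v (P.node i.castSucc) = v i.castSucc := by
  rw [P.envelope_eq_line hv (i := i), line, sub_self, mul_zero, add_zero]
  exact ⟨Or.inr le_rfl, Or.inr (P.strictMono.monotone (Fin.castSucc_lt_succ).le)⟩

/-! ### The smoothing as a moving average -/

/-- The derivative of the moving average of the envelope over windows of length `minMesh`. -/
noncomputable def windowSlope (v : Fin (N + 1) → ℝ) (x : ℝ) : ℝ :=
  (P.envelope v (x + P.minMesh / 2) - P.envelope v (x - P.minMesh / 2)) / P.minMesh

theorem continuous_windowSlope (v : Fin (N + 1) → ℝ) : Continuous (P.windowSlope v) := by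
  have := P.continuous_envelope v
  unfold windowSlope
  fun_prop

/-- The derivative of the moving average of the envelope lies between the two slopes that the
window meets. -/
theorem windowSlope_mem (hv : Antitone (P.slope v)) {x : ℝ} {i j : Fin N}
    (hi : P.InRightCell i (x - P.minMesh / 2)) (hj : P.InRightCell j (x + P.minMesh / 2)) :
    P.windowSlope v x ∈ Icc (P.slope v j) (P.slope v i) := by
  have hd := P.minMesh_pos
  rw [windowSlope, P.envelope_eq_line hv hi.inCell, P.envelope_eq_line hv hj.inCell, mem_Icc,
    le_div_iff₀ hd, div_le_iff₀ hd]
  rcases P.cells_of_window hi hj with rfl | ⟨h, h1, h2⟩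
  · constructor <;> (rw [line, line]; linarith)
  · have hF : P.slope v j ≤ P.slope v i := hv (by rw [Fin.le_def]; omega)
    rw [P.line_eq_right v i, P.line_next v h]
    constructor <;> nlinarith

theorem hasDerivWithinAt_envelope (hv : Antitone (P.slope v)) {y : ℝ} {i : Fin N}
    (hi : P.InRightCell i y) : HasDerivWithinAt (P.envelope v) (P.slope v i) (Ici y) y := by
  refine (P.hasDerivAt_line v i y).hasDerivWithinAt.congr_of_eventuallyEq ?_
    (P.envelope_eq_line hv hi.inCell)
  filter_upwards [hi.eventually] with t ht using P.envelope_eq_line hv ht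

theorem hasDerivWithinAt_windowSlope (hv : Antitone (P.slope v)) {x : ℝ} {i j : Fin N}
    (hi : P.InRightCell i (x - P.minMesh / 2)) (hj : P.InRightCell j (x + P.minMesh / 2)) :
    HasDerivWithinAt (P.windowSlope v)
      ((P.slope v j - P.slope v i) / P.minMesh) (Ici x) x := by
  have hm : ∀ c : ℝ, MapsTo (fun z => z + c) (Ici x) (Ici (x + c)) := fun c z hz => by
    simpa using hz
  have h1 := (P.hasDerivWithinAt_envelope hv hj).comp x
    ((hasDerivWithinAt_id x (Ici x)).add_const (P.minMesh / 2)) (hm _)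
  have h2 := (P.hasDerivWithinAt_envelope hv hi).comp x
    ((hasDerivWithinAt_id x (Ici x)).sub_const (P.minMesh / 2)) (fun z hz => by simpa using hz)
  have h3 := (h1.sub h2).div_const P.minMesh
  rw [mul_one, mul_one] at h3
  exact h3

theorem antitoneOn_windowSlope (hv : Antitone (P.slope v)) (a b : ℝ) :
    AntitoneOn (P.windowSlope v) (Icc a b) := by
  choose c hc using P.exists_inRightCell
  refine antitoneOn_of_deriv_right_nonpos (P.continuous_windowSlope v).continuousOn
    (fun x _ => P.hasDerivWithinAt_windowSlope hv (hc _) (hc _)) fun x _ => ?_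
  have h := P.windowSlope_mem hv (hc (x - P.minMesh / 2)) (hc (x + P.minMesh / 2))
  exact div_nonpos_of_nonpos_of_nonneg (sub_nonpos.2 (h.1.trans h.2)) P.minMesh_pos.le

theorem concaveOn_movingAverage_envelope (hv : Antitone (P.slope v)) :
    ConcaveOn ℝ (Icc 0 1) (movingAverage (P.envelope v) P.minMesh) := by
  have hs := hasDerivAt_movingAverage (P.continuous_envelope v) P.minMesh
  refine AntitoneOn.concaveOn_of_deriv (convex_Icc 0 1)
    (fun x _ => (hs x).continuousAt.continuousWithinAt)
    (fun x _ => (hs x).differentiableAt.differentiableWithinAt) ?_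
  rw [show deriv (movingAverage (P.envelope v) P.minMesh) = P.windowSlope v from
    funext fun x => (hs x).deriv]
  exact (P.antitoneOn_windowSlope hv 0 1).mono interior_subset

/-- The cells that the window about a point of the `k`-th interval meets are on both sides of the
`k`-th cell. -/
theorem le_le_of_mem_Icc {x : ℝ} {i j k : Fin N} (hi : P.InRightCell i (x - P.minMesh / 2))
    (hj : P.InRightCell j (x + P.minMesh / 2))
    (hk : x ∈ Icc (P.node k.castSucc) (P.node k.succ)) : i ≤ k ∧ k ≤ j := by
  have hd := P.minMesh_pos
  constructor
  · by_contra! h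
    have h1 := P.node_succ_le_castSucc h
    rw [Fin.lt_def] at h
    rcases hi.1 with h2 | h2
    · omega
    · linarith [hk.2]
  · by_contra! h
    have h1 := P.node_succ_le_castSucc h
    have := k.isLt
    rw [Fin.lt_def] at h
    rcases hj.2 with h2 | h2
    · omega
    · linarith [hk.1]

theorem abs_movingAverage_envelope_sub_node_le (hv : Antitone (P.slope v)) {L : ℝ}
    (hL : ∀ i, |P.slope v i| ≤ L) {x r : ℝ} (k : Fin (N + 1)) (hr : |x - P.node k| ≤ r) :
    |movingAverage (P.envelope v) P.minMesh x - v k| ≤ L * (r + P.minMesh / 2) := by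
  have hk : P.envelope v (P.node k) = v k := by
    by_cases h : k = 0
    · rw [h]
      exact P.envelope_node_castSucc hv ⟨0, P.pos⟩
    · obtain ⟨i, rfl⟩ := Fin.exists_succ_eq.2 h
      exact P.envelope_node_succ hv i
  have hL0 : 0 ≤ L := (abs_nonneg _).trans (hL ⟨0, P.pos⟩)
  refine abs_movingAverage_sub_le_of_forall (P.continuous_envelope v) P.minMesh_pos
    fun t ht => ?_
  rw [← hk]
  refine (P.abs_envelope_sub_le hL _ _).trans ?_
  gcongr
  have h1 : |t - x| ≤ P.minMesh / 2 := by
    rw [abs_le]; constructor <;> linarith [ht.1, ht.2]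
  have h2 := abs_sub_le t x (P.node k)
  linarith

theorem movingAverage_envelope_of_inCell (hv : Antitone (P.slope v)) {x : ℝ} {i : Fin N}
    (h1 : P.InCell i (x - P.minMesh / 2)) (h2 : P.InCell i (x + P.minMesh / 2)) :
    movingAverage (P.envelope v) P.minMesh x = P.line v i x := by
  have hd := P.minMesh_pos
  have e : ∫ t in (x - P.minMesh / 2)..(x + P.minMesh / 2), P.envelope v t
      = ∫ t in (x - P.minMesh / 2)..(x + P.minMesh / 2), P.line v i t := by
    refine intervalIntegral.integral_congr fun t ht => ?_
    rw [uIcc_of_le (by linarith)] at ht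
    exact P.envelope_eq_line hv ⟨h1.1.imp_right fun h => h.trans ht.1,
      h2.2.imp_right fun h => ht.2.trans h⟩
  rw [movingAverage, e]
  simp only [line]
  rw [integral_affine]
  field_simp
  ring

/-- The window about a point near an interior node splits into two pieces, on each of which the
envelope is affine; this gives the quadratic of the definition. -/
theorem movingAverage_envelope_near (hv : Antitone (P.slope v)) {x : ℝ} {i j : Fin N}
    (hij : (j : ℕ) = i + 1)
    (hx : x ∈ Icc (P.node i.succ - P.minMesh / 2) (P.node i.succ + P.minMesh / 2)) :
    movingAverage (P.envelope v) P.minMesh x =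
      (v i.succ * P.minMesh + (P.slope v j * (x + P.minMesh / 2 - P.node i.succ) ^ 2
        - P.slope v i * (x - P.minMesh / 2 - P.node i.succ) ^ 2) / 2) / P.minMesh := by
  have hd := P.minMesh_pos
  have hc := P.continuous_envelope v
  have gi := P.minMesh_le_gap i
  have gj := P.minMesh_le_gap j
  have hcs := castSucc_eq_succ hij
  rw [gap] at gi gj
  rw [hcs] at gj
  obtain ⟨hx1, hx2⟩ := hx
  have e1 : ∫ t in (x - P.minMesh / 2)..(P.node i.succ), P.envelope v t
      = ∫ t in (x - P.minMesh / 2)..(P.node i.succ),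
          (v i.succ + P.slope v i * (t - P.node i.succ)) := by
    refine intervalIntegral.integral_congr fun t ht => ?_
    rw [uIcc_of_le (by linarith)] at ht
    have := P.envelope_eq_line hv (i := i) (y := t)
      ⟨Or.inr (by linarith [ht.1]), Or.inr ht.2⟩
    rw [this, line_eq_right]
  have e2 : ∫ t in (P.node i.succ)..(x + P.minMesh / 2), P.envelope v t
      = ∫ t in (P.node i.succ)..(x + P.minMesh / 2),
          (v i.succ + P.slope v j * (t - P.node i.succ)) := by
    refine intervalIntegral.integral_congr fun t ht => ?_
    rw [uIcc_of_le (by linarith)] at ht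
    have := P.envelope_eq_line hv (i := j) (y := t)
      ⟨Or.inr (by rw [hcs]; exact ht.1), Or.inr (by linarith [ht.2])⟩
    rw [this, P.line_next v hij]
  rw [movingAverage, ← intervalIntegral.integral_add_adjacent_intervals
    (hc.intervalIntegrable _ (P.node i.succ)) (hc.intervalIntegrable _ _), e1, e2,
    integral_affine, integral_affine]
  congr 1
  ring

/-- On `[0,1]` the smoothing is the moving average of the concave extension of the interpolant. -/
theorem smoothing_eq_movingAverage (l : Fin (N + 1) → ℝ)
    (hv : Antitone (P.slope fun i => Real.exp (l i))) {x : ℝ} (hx : x ∈ Icc (0 : ℝ) 1) :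
    P.smoothing l x = movingAverage (P.envelope fun i => Real.exp (l i)) P.minMesh x := by
  have hd := P.minMesh_pos
  set v : Fin (N + 1) → ℝ := fun i => Real.exp (l i) with hvdef
  by_cases h : ∃ i, P.NearInterior i x
  · rw [smoothing, dif_pos h]
    obtain ⟨h0, hl, hmem⟩ := h.choose_spec
    generalize h.choose = k at h0 hl hmem
    obtain ⟨i, rfl⟩ := Fin.exists_succ_eq.2 h0
    have hiN : (i : ℕ) + 1 < N := by
      have : (i.succ : ℕ) ≠ N := fun h => hl (Fin.ext (by simpa using h))
      simp only [Fin.val_succ] at this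
      have := i.isLt
      omega
    let j : Fin N := ⟨i + 1, hiN⟩
    have hij : (j : ℕ) = i + 1 := rfl
    have hcs := castSucc_eq_succ hij
    have gi := P.minMesh_le_gap i
    have gj := P.minMesh_le_gap j
    rw [gap] at gi gj
    rw [hcs] at gj
    have f0 : P.expInterp l (P.node i.succ) = v i.succ := by
      rw [expInterp, P.interp_eq _ i ⟨by linarith, le_rfl⟩]
      exact (P.line_eq_right v i _).trans (by simp)
    have fm : P.expInterp l (P.node i.succ - P.minMesh)
        = v i.succ - P.slope v i * P.minMesh := by
      rw [expInterp, P.interp_eq _ i ⟨by linarith, by linarith⟩]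
      exact (P.line_eq_right v i _).trans (by ring)
    have fp : P.expInterp l (P.node i.succ + P.minMesh)
        = v i.succ + P.slope v j * P.minMesh := by
      rw [expInterp, P.interp_eq _ j ⟨by rw [hcs]; linarith, by linarith⟩]
      exact (P.line_next v hij _).trans (by ring)
    rw [P.movingAverage_envelope_near hv hij hmem]
    simp only [quad, f0, fm, fp]
    field_simp
    ring
  · rw [smoothing, dif_neg h, expInterp]
    obtain ⟨i, hi⟩ := P.exists_inRightCell x
    have hn : ∀ k : Fin (N + 1), k ≠ 0 → k ≠ Fin.last N →
        x < P.node k - P.minMesh / 2 ∨ P.node k + P.minMesh / 2 < x := by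
      intro k h1 h2
      by_contra! hc
      exact h ⟨k, h1, h2, hc.1, hc.2⟩
    rw [P.interp_eq_line _ hx hi.inCell]
    refine (P.movingAverage_envelope_of_inCell hv ⟨?_, ?_⟩ ⟨?_, ?_⟩).symm
    · rcases hi.1 with h1 | h1
      · exact Or.inl h1
      · by_cases h0 : (i : ℕ) = 0
        · exact Or.inl h0
        · right
          rcases hn i.castSucc (fun h => h0 (by simpa using congrArg Fin.val h))
            (Fin.castSucc_lt_last i).ne with h2 | h2 <;> linarith
    · rcases hi.2 with h1 | h1
      · exact Or.inl h1
      · right; linarith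
    · rcases hi.1 with h1 | h1
      · exact Or.inl h1
      · right; linarith
    · by_cases h0 : (i : ℕ) + 1 = N
      · exact Or.inl h0
      · rcases hi.2 with h1 | h1
        · exact Or.inl h1
        · right
          rcases hn i.succ (Fin.succ_ne_zero i)
            (fun h => h0 (by simpa using congrArg Fin.val h)) with h2 | h2 <;> linarith

/-! ### One-sided derivatives of the interpolant -/

theorem derivWithin_interp_Ici (v : Fin (N + 1) → ℝ) {x : ℝ} (hx : x ∈ Ico (0 : ℝ) 1) :
    ∃ k : Fin N, x ∈ Icc (P.node k.castSucc) (P.node k.succ) ∧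
      derivWithin (P.interp v) (Ici x) x = P.slope v k := by
  obtain ⟨k, hk⟩ := P.exists_inRightCell x
  have h1 : P.node k.castSucc ≤ x := by
    rcases hk.1 with h | h
    · rw [P.node_castSucc_of_val_zero h]; exact hx.1
    · exact h
  have h2 : x < P.node k.succ := by
    rcases hk.2 with h | h
    · rw [P.node_succ_of_val_last h]; exact hx.2
    · exact h
  refine ⟨k, ⟨h1, h2.le⟩, ?_⟩
  refine ((P.hasDerivAt_line v k x).hasDerivWithinAt.congr_of_eventuallyEq ?_
    (P.interp_eq v k ⟨h1, h2.le⟩)).derivWithin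
    (uniqueDiffOn_Ici x x self_mem_Ici)
  filter_upwards [self_mem_nhdsWithin, mem_nhdsWithin_of_mem_nhds (Iio_mem_nhds h2)] with t ht ht2
  exact P.interp_eq v k ⟨h1.trans ht, le_of_lt ht2⟩

/-- Left-open intervals, as needed for left derivatives at a node. -/
theorem exists_mem_Ioc {x : ℝ} (hx : x ∈ Ioc (0 : ℝ) 1) :
    ∃ k : Fin N, x ∈ Ioc (P.node k.castSucc) (P.node k.succ) := by
  obtain ⟨i, hi⟩ := P.exists_inRightCell x
  have h2 : x ≤ P.node i.succ := by
    rcases hi.2 with h | h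
    · rw [P.node_succ_of_val_last h]; exact hx.2
    · exact h.le
  by_cases h0 : (i : ℕ) = 0
  · exact ⟨i, by rw [P.node_castSucc_of_val_zero h0]; exact hx.1, h2⟩
  rcases (hi.1.resolve_left h0).lt_or_eq with h | h
  · exact ⟨i, h, h2⟩
  · have hk : (i : ℕ) - 1 < N := by have := i.isLt; omega
    let k : Fin N := ⟨i - 1, hk⟩
    have e : i.castSucc = k.succ := castSucc_eq_succ (by simp only [k]; omega)
    refine ⟨k, ?_, ?_⟩
    · rw [← h, e]; exact P.strictMono Fin.castSucc_lt_succ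
    · rw [← h, e]

theorem derivWithin_interp_Iic (v : Fin (N + 1) → ℝ) {x : ℝ} (hx : x ∈ Ioc (0 : ℝ) 1) :
    ∃ k : Fin N, x ∈ Icc (P.node k.castSucc) (P.node k.succ) ∧
      derivWithin (P.interp v) (Iic x) x = P.slope v k := by
  obtain ⟨k, h1, h2⟩ := P.exists_mem_Ioc hx
  refine ⟨k, ⟨h1.le, h2⟩, ?_⟩
  refine ((P.hasDerivAt_line v k x).hasDerivWithinAt.congr_of_eventuallyEq ?_
    (P.interp_eq v k ⟨h1.le, h2⟩)).derivWithin
    (uniqueDiffOn_Iic x x self_mem_Iic)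
  filter_upwards [self_mem_nhdsWithin, mem_nhdsWithin_of_mem_nhds (Ioi_mem_nhds h1)] with t ht ht2
  exact P.interp_eq v k ⟨le_of_lt ht2, le_trans ht h2⟩

end UnitPartition

/-! ### The curvature of the logarithm near a node -/

/-- Two consecutive slopes of the exponentials differ little. Here `fi`, `fj` are the slopes of
`exp ∘ l` on both sides of a node, divided by the value of `exp ∘ l` there, `si`, `sj` are those of
`l`, and `gi`, `gj` are the lengths of the intervals. -/
theorem slope_jump_le {β B m d fi fj si sj gi gj : ℝ} (hβ : 0 ≤ β) (hB : 0 ≤ B)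
    (hmd : B * (m * d) ≤ 1)
    (hgi : 0 ≤ gi) (hgj : 0 ≤ gj) (hgi' : gi ≤ m * d) (hgj' : gj ≤ m * d)
    (hb : -(β / 2 * (gi + gj)) ≤ sj - si)
    (hj : sj + sj ^ 2 * gj / 2 - B ^ 3 * gj ^ 2 ≤ fj)
    (hi : fi ≤ si - si ^ 2 * gi / 2 + B ^ 3 * gi ^ 2) :
    fi - fj ≤ (β + 2 * B ^ 2) * m * d := by
  have h1 : 0 ≤ sj ^ 2 * gj := by positivity
  have h2 : 0 ≤ si ^ 2 * gi := by positivity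
  have hc : ∀ g, 0 ≤ g → g ≤ m * d → B ^ 3 * g ^ 2 ≤ B ^ 2 * (m * d) := by
    intro g h0 h
    have h3 : B * g ≤ 1 := (by gcongr : B * g ≤ B * (m * d)).trans hmd
    calc B ^ 3 * g ^ 2 = B ^ 2 * g * (B * g) := by ring
      _ ≤ B ^ 2 * g * 1 := by gcongr
      _ ≤ B ^ 2 * (m * d) := by rw [mul_one]; gcongr
  have h3 := hc gi hgi hgi'
  have h4 := hc gj hgj hgj'
  have h5 : β / 2 * (gi + gj) ≤ β / 2 * (m * d + m * d) := by gcongr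
  linarith

/-- The lower bound on the second derivative of `log (s + ε)` at a point whose window contains a
node, for `s`, its derivatives and `ε` divided by the nodal value of `exp ∘ l`: `p` and `q` stand
for the first derivative and for `s + ε`. The term `ε` makes `q` exceed `1` by more than the
discretization error, which is where the smoothing gains its margin. -/
theorem curvature_lower_bound {β B m M d fi fj si sj gi gj p q : ℝ} (hβ : 0 ≤ β) (hB : 0 ≤ B)
    (hM : 0 ≤ M) (hm : 0 ≤ m) (hd : 0 < d) (hd1 : d ≤ 1)
    (hmd : B * (m * d) ≤ 1) (hgi : d ≤ gi) (hgj : d ≤ gj) (hgi' : gi ≤ m * d) (hgj' : gj ≤ m * d)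
    (hgiM : gi ≤ d + M * d ^ 3) (hgjM : gj ≤ d + M * d ^ 3)
    (hsi : |si| ≤ B) (hsj : |sj| ≤ B)
    (hb : -(β / 2 * (gi + gj)) ≤ sj - si)
    (hj : sj + sj ^ 2 * gj / 2 - B ^ 3 * gj ^ 2 ≤ fj) (hj' : |fj - sj| ≤ B ^ 2 * gj)
    (hi : fi ≤ si - si ^ 2 * gi / 2 + B ^ 3 * gi ^ 2) (hi' : |fi - si| ≤ B ^ 2 * gi)
    (hp : p ∈ Icc fj fi) (hq1 : 1 ≤ q)
    (hq : (4 * B * (B ^ 2 * m + (β + 2 * B ^ 2) * m) + β * M + 2 * B ^ 3 * m ^ 2) * d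
      ≤ β * (q - 1)) :
    -β ≤ (fj - fi) / d / q - (p / q) ^ 2 := by
  have hgi0 : 0 ≤ gi := hd.le.trans hgi
  have hgj0 : 0 ≤ gj := hd.le.trans hgj
  have hJ := slope_jump_le hβ hB hmd hgi0 hgj0 hgi' hgj' hb hj hi
  obtain ⟨hp1, hp2⟩ := hp
  set C3 := B ^ 2 * m + (β + 2 * B ^ 2) * m with hC3
  have hC30 : 0 ≤ C3 := by positivity
  set C4 := 4 * B * C3 + β * M + 2 * B ^ 3 * m ^ 2 with hC4
  have hBg : ∀ g, g ≤ m * d → B ^ 2 * g ≤ B ^ 2 * m * d := fun g h => by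
    rw [mul_assoc]; gcongr
  have hBB : B ^ 2 * m * d ≤ B := by
    have : B * (B * (m * d)) ≤ B * 1 := by gcongr
    linarith
  have hC3d : C3 * d = B ^ 2 * m * d + (β + 2 * B ^ 2) * m * d := by rw [hC3]; ring
  have hpi : |p - si| ≤ C3 * d := by
    have := hBg gi hgi'
    rw [abs_le] at hi' ⊢
    constructor <;> linarith
  have hpj : |p - sj| ≤ C3 * d := by
    have := hBg gj hgj'
    rw [abs_le] at hj' ⊢
    constructor <;> linarith
  have hpB : |p| ≤ 2 * B := by
    have h1 := hBg gi hgi'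
    have h2 := hBg gj hgj'
    rw [abs_le] at hi' hj' hsi hsj ⊢
    constructor <;> linarith
  have hsq : ∀ s, |p - s| ≤ C3 * d → p ^ 2 - 4 * B * C3 * d ≤ s ^ 2 := by
    intro s hs
    have h1 : p * (p - s) ≤ 2 * B * (C3 * d) := by
      refine (le_abs_self _).trans ?_
      rw [abs_mul]
      gcongr
    linarith [sq_nonneg (p - s)]
  -- The nodal constraint and the quadratic terms of the expansion combine to `(s ^ 2 - β) * g / 2`
  -- on each side; replacing `g` by `d` costs only the cubic mesh defect.
  have hterm : ∀ s g, d ≤ g → g ≤ d + M * d ^ 3 → g ≤ m * d → |p - s| ≤ C3 * d →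
      (p ^ 2 - 4 * B * C3 * d - β) * d / 2 - β * M * d ^ 2 / 2 - B ^ 3 * m ^ 2 * d ^ 2
        ≤ (s ^ 2 - β) * g / 2 - B ^ 3 * g ^ 2 := by
    intro s g h1 h2 h3 h4
    have h5 := hsq s h4
    have h6 : B ^ 3 * g ^ 2 ≤ B ^ 3 * (m * d) ^ 2 := by
      have : 0 ≤ g := hd.le.trans h1
      gcongr
    have h7 : (p ^ 2 - 4 * B * C3 * d) * d ≤ s ^ 2 * g :=
      (mul_le_mul_of_nonneg_right h5 hd.le).trans (by gcongr)
    have h8 : β * g ≤ β * (d + M * d ^ 2) := by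
      have : d ^ 3 ≤ d ^ 2 := pow_le_pow_of_le_one hd.le hd1 (by norm_num)
      have : M * d ^ 3 ≤ M * d ^ 2 := by gcongr
      gcongr
      linarith
    linarith
  have hS : p ^ 2 - β - C4 * d ≤ (fj - fi) / d := by
    rw [le_div_iff₀ hd]
    have h1 := hterm si gi hgi hgiM hgi' hpi
    have h2 := hterm sj gj hgj hgjM hgj' hpj
    rw [hC4]
    linarith
  have hq0 : 0 < q := by linarith
  have key : 0 ≤ (fj - fi) / d * q - p ^ 2 + β * q ^ 2 := by
    have h1 : (p ^ 2 - β - C4 * d) * q ≤ (fj - fi) / d * q := by gcongr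
    have h2 : 0 ≤ q * (β * (q - 1) - C4 * d) := mul_nonneg hq0.le (by linarith)
    have h3 : 0 ≤ (q - 1) * p ^ 2 := mul_nonneg (by linarith) (sq_nonneg p)
    linarith
  have e : (fj - fi) / d / q - (p / q) ^ 2 + β = ((fj - fi) / d * q - p ^ 2 + β * q ^ 2) / q ^ 2 := by
    field_simp
  have : 0 ≤ ((fj - fi) / d * q - p ^ 2 + β * q ^ 2) / q ^ 2 := by positivity
  linarith

namespace UnitPartition

variable {N : ℕ} {P : UnitPartition N} {β M : ℝ} {l : Fin (N + 1) → ℝ}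

/-! ### Bounds for feasible vectors -/

/-- The interpolant of the exponentials is concave. -/
theorem Feasible.antitone_slope_exp (h : P.Feasible β l) :
    Antitone (P.slope fun i => Real.exp (l i)) := by
  have key : Monotone fun i => -P.slope (fun i => Real.exp (l i)) i := by
    refine Fin.monotone_of_le_next fun i j hij => neg_le_neg ?_
    have hcs := castSucc_eq_succ hij
    have gi := P.gap_pos i
    have gj := P.gap_pos j
    have hc := h.expConcave i j hij
    rw [slope, slope, div_le_div_iff₀ gj gi]
    rw [gap] at gi
    rw [gap, hcs] at gj
    rw [gap, gap, hcs]
    set a := P.node i.castSucc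
    set c := P.node i.succ
    set b := P.node j.succ
    have hab : 0 < b - a := by linarith
    have e : (c - a) / (b - a) * Real.exp (l j.succ)
        + (1 - (c - a) / (b - a)) * Real.exp (l i.castSucc)
        = ((c - a) * Real.exp (l j.succ) + (b - c) * Real.exp (l i.castSucc)) / (b - a) := by
      field_simp
      ring
    have hpos : 0 < ((c - a) * Real.exp (l j.succ) + (b - c) * Real.exp (l i.castSucc))
        / (b - a) := by positivity
    rw [e] at hc
    have h1 := (Real.log_le_iff_le_exp hpos).1 (by linarith :
      Real.log (((c - a) * Real.exp (l j.succ) + (b - c) * Real.exp (l i.castSucc)) / (b - a))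
        ≤ l i.succ)
    rw [div_le_iff₀ hab] at h1
    linarith
  exact fun i j hij => neg_le_neg_iff.1 (key hij)

/-- The constraint on the slopes says that they increase once an affine function of the midpoints
is added, so that the bounds at both ends carry over to the other intervals. -/
theorem Feasible.abs_slope_le (h : P.Feasible β l) (hβ : 0 ≤ β) (i : Fin N) :
    |P.slope l i| ≤ √β + β := by
  have mono : Monotone fun k : Fin N =>
      P.slope l k + β / 2 * (P.node k.succ + P.node k.castSucc) := by
    refine Fin.monotone_of_le_next fun i j hij => ?_
    have := h.smooth i j hij
    rw [castSucc_eq_succ hij]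
    linarith
  have h0 := Real.abs_le_sqrt (sub_nonpos.1 (h.left_end ⟨0, P.pos⟩ rfl))
  have h1 := Real.abs_le_sqrt (sub_nonpos.1 (h.right_end ⟨N - 1, Nat.sub_one_lt P.pos.ne'⟩
    (Nat.sub_one_add_one P.pos.ne')))
  have m0 := mono (Fin.mk_le_mk.2 (Nat.zero_le _) : (⟨0, P.pos⟩ : Fin N) ≤ i)
  have m1 := mono (by rw [Fin.le_def]; simp only; omega :
    i ≤ (⟨N - 1, Nat.sub_one_lt P.pos.ne'⟩ : Fin N))
  simp only at m0 m1
  have hn : ∀ k : Fin N, 0 ≤ β / 2 * (P.node k.succ + P.node k.castSucc) ∧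
      β / 2 * (P.node k.succ + P.node k.castSucc) ≤ β := by
    intro k
    have a1 := P.node_mem k.succ
    have a2 := P.node_mem k.castSucc
    rw [mem_Icc] at a1 a2
    constructor
    · have := a1.1; have := a2.1; positivity
    · have : β / 2 * (P.node k.succ + P.node k.castSucc) ≤ β / 2 * (1 + 1) := by
        gcongr <;> linarith
      linarith
  have q0 := hn ⟨0, P.pos⟩
  have q1 := hn ⟨N - 1, Nat.sub_one_lt P.pos.ne'⟩
  have q2 := hn i
  rw [abs_le] at *
  constructor <;> linarith

theorem Feasible.exists_node_half (h : P.Feasible β l) : ∃ k, l k = 0 := by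
  obtain ⟨k, hk⟩ := P.half_mem
  refine ⟨k, ?_⟩
  have hh := h.half
  have hk0 : k ≠ 0 := by
    rintro rfl
    rw [P.node_zero] at hk
    norm_num at hk
  obtain ⟨i, rfl⟩ := Fin.exists_succ_eq.2 hk0
  rw [← hk, P.interp_eq l i ⟨P.strictMono.monotone (Fin.castSucc_lt_succ).le, le_rfl⟩] at hh
  have := P.line_eq_right l i (P.node i.succ)
  rw [line, hh] at this
  simpa using this.symm

theorem Feasible.abs_node_le (h : P.Feasible β l) (hβ : 0 ≤ β) (i : Fin (N + 1)) :
    |l i| ≤ √β + β := by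
  set B := √β + β
  have hB : 0 ≤ B := by positivity
  have hs : ∀ k : Fin N, |l k.succ - l k.castSucc| ≤ B * (P.node k.succ - P.node k.castSucc) := by
    intro k
    have h1 := h.abs_slope_le hβ k
    have h2 := P.gap_pos k
    rw [← P.slope_mul_gap, abs_mul, abs_of_pos h2]
    exact mul_le_mul_of_nonneg_right h1 h2.le
  have m1 : Monotone fun k => B * P.node k + l k := by
    refine Fin.monotone_iff_le_succ.2 fun k => ?_
    have := (abs_le.1 (hs k)).1
    linarith
  have m2 : Monotone fun k => B * P.node k - l k := by
    refine Fin.monotone_iff_le_succ.2 fun k => ?_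
    have := (abs_le.1 (hs k)).2
    linarith
  obtain ⟨c, hc⟩ := h.exists_node_half
  have b : ∀ k, 0 ≤ B * P.node k ∧ B * P.node k ≤ B := fun k =>
    ⟨mul_nonneg hB (P.node_mem k).1, mul_le_of_le_one_right hB (P.node_mem k).2⟩
  have b1 := b i
  have b2 := b c
  rw [abs_le]
  rcases le_total i c with hic | hic
  · have a1 := m1 hic
    have a2 := m2 hic
    simp only [hc] at a1 a2
    constructor <;> linarith
  · have a1 := m1 hic
    have a2 := m2 hic
    simp only [hc] at a1 a2
    constructor <;> linarith

/-! ### The logarithmic derivative of the smoothing -/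

/-- The mesh is nearly uniform, with defect of third order, and it is so small that the increment
over one interval of a function with slopes at most `B` does not exceed `1`. -/
structure Fine (P : UnitPartition N) (M B : ℝ) : Prop where
  nonneg : 0 ≤ M
  mesh_sub : |P.mesh - P.minMesh| ≤ M * P.minMesh ^ 3
  le_one : P.minMesh ≤ 1
  mul_le : B * ((1 + M) * P.minMesh) ≤ 1

theorem Fine.gap_le_add_cube {B : ℝ} (hP : P.Fine M B) (i : Fin N) :
    P.gap i ≤ P.minMesh + M * P.minMesh ^ 3 := by
  linarith [P.gap_le_mesh i, (abs_le.1 hP.mesh_sub).2]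

theorem Fine.gap_le {B : ℝ} (hP : P.Fine M B) (i : Fin N) : P.gap i ≤ (1 + M) * P.minMesh := by
  have h1 := hP.gap_le_add_cube i
  have hM := hP.nonneg
  have h2 : M * P.minMesh ^ 3 ≤ M * P.minMesh := by
    gcongr
    exact pow_le_of_le_one P.minMesh_pos.le hP.le_one (by norm_num)
  linarith

theorem Fine.mul_gap_le {B : ℝ} (hP : P.Fine M B) (hB : 0 ≤ B) (i : Fin N) : B * P.gap i ≤ 1 :=
  (mul_le_mul_of_nonneg_left (hP.gap_le i) hB).trans hP.mul_le

theorem Feasible.exp_le (h : P.Feasible β l) (hβ : 0 ≤ β) (k : Fin (N + 1)) :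
    Real.exp (l k) ≤ Real.exp (√β + β) :=
  Real.exp_le_exp.2 (abs_le.1 (h.abs_node_le hβ k)).2

theorem Feasible.le_exp (h : P.Feasible β l) (hβ : 0 ≤ β) (k : Fin (N + 1)) :
    Real.exp (-(√β + β)) ≤ Real.exp (l k) :=
  Real.exp_le_exp.2 (abs_le.1 (h.abs_node_le hβ k)).1

theorem Feasible.slope_exp_left (h : P.Feasible β l) (hβ : 0 ≤ β) (hP : P.Fine M (√β + β))
    (i : Fin N) :
    |P.slope (fun k => Real.exp (l k)) i - Real.exp (l i.castSucc) * P.slope l i|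
        ≤ Real.exp (l i.castSucc) * ((√β + β) ^ 2 * P.gap i) ∧
      Real.exp (l i.castSucc) * (P.slope l i + P.slope l i ^ 2 * P.gap i / 2
        - (√β + β) ^ 3 * P.gap i ^ 2) ≤ P.slope (fun k => Real.exp (l k)) i :=
  exp_slope_left (P.gap_pos i) (h.abs_slope_le hβ i) (hP.mul_gap_le (by positivity) i)

theorem Feasible.slope_exp_right (h : P.Feasible β l) (hβ : 0 ≤ β) (hP : P.Fine M (√β + β))
    (i : Fin N) :
    |P.slope (fun k => Real.exp (l k)) i - Real.exp (l i.succ) * P.slope l i|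
        ≤ Real.exp (l i.succ) * ((√β + β) ^ 2 * P.gap i) ∧
      P.slope (fun k => Real.exp (l k)) i ≤ Real.exp (l i.succ) * (P.slope l i
        - P.slope l i ^ 2 * P.gap i / 2 + (√β + β) ^ 3 * P.gap i ^ 2) :=
  exp_slope_right (P.gap_pos i) (h.abs_slope_le hβ i) (hP.mul_gap_le (by positivity) i)

theorem Feasible.abs_slope_exp_le (h : P.Feasible β l) (hβ : 0 ≤ β) (hP : P.Fine M (√β + β))
    (i : Fin N) :
    |P.slope (fun k => Real.exp (l k)) i| ≤ 2 * (√β + β) * Real.exp (√β + β) := by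
  set B := √β + β with hB
  have hB0 : 0 ≤ B := by positivity
  have h1 := (h.slope_exp_left hβ hP i).1
  rw [← hB] at h1
  have h2 : B ^ 2 * P.gap i ≤ B := by
    have : B * (B * P.gap i) ≤ B * 1 := by
      gcongr
      exact hP.mul_gap_le hB0 i
    linarith
  have h3 : |Real.exp (l i.castSucc) * P.slope l i| ≤ Real.exp (l i.castSucc) * B := by
    rw [abs_mul, abs_of_pos (Real.exp_pos _)]
    gcongr
    exact h.abs_slope_le hβ i
  have h4 := abs_sub_abs_le_abs_sub (P.slope (fun k => Real.exp (l k)) i)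
    (Real.exp (l i.castSucc) * P.slope l i)
  have h5 : Real.exp (l i.castSucc) * (B ^ 2 * P.gap i) ≤ Real.exp (l i.castSucc) * B := by gcongr
  have h6 : Real.exp (l i.castSucc) * B ≤ Real.exp B * B := by
    gcongr
    exact (abs_le.1 (h.abs_node_le hβ _)).2
  linarith

theorem Feasible.slope_exp_sub_le (h : P.Feasible β l) (hβ : 0 ≤ β) (hP : P.Fine M (√β + β))
    {i j : Fin N} (hij : (j : ℕ) = i + 1) :
    P.slope (fun k => Real.exp (l k)) i - P.slope (fun k => Real.exp (l k)) j
      ≤ Real.exp (√β + β) * ((β + 2 * (√β + β) ^ 2) * (1 + M) * P.minMesh) := by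
  have hM := hP.nonneg
  have hd := P.minMesh_pos
  have hcs := castSucc_eq_succ hij
  have hE := Real.exp_pos (l i.succ)
  have h1 := (h.slope_exp_right hβ hP i).2
  have h2 := (h.slope_exp_left hβ hP j).2
  have h3 := h.smooth i j hij
  rw [hcs] at h2
  have key := slope_jump_le (β := β) (B := √β + β) (m := 1 + M) (d := P.minMesh)
    (fi := P.slope (fun k => Real.exp (l k)) i / Real.exp (l i.succ))
    (fj := P.slope (fun k => Real.exp (l k)) j / Real.exp (l i.succ))
    hβ (by positivity) hP.mul_le (P.gap_pos i).le (P.gap_pos j).le (hP.gap_le i) (hP.gap_le j)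
    (si := P.slope l i) (sj := P.slope l j)
    (by rw [gap, gap, hcs]; linarith)
    (by rw [le_div_iff₀ hE]; linarith) (by rw [div_le_iff₀ hE]; linarith)
  rw [← sub_div, div_le_iff₀ hE] at key
  refine key.trans ?_
  rw [mul_comm]
  gcongr
  exact (abs_le.1 (h.abs_node_le hβ _)).2

/-- The smoothing is within `O(minMesh)` of the exponentials at the ends of the interval. -/
theorem Feasible.abs_movingAverage_sub_le (h : P.Feasible β l) (hβ : 0 ≤ β)
    (hP : P.Fine M (√β + β)) {x : ℝ} {k : Fin N}
    (hk : x ∈ Icc (P.node k.castSucc) (P.node k.succ)) :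
    |movingAverage (P.envelope fun k => Real.exp (l k)) P.minMesh x - Real.exp (l k.castSucc)|
      ≤ 2 * (√β + β) * Real.exp (√β + β) * (2 + M) * P.minMesh := by
  have hd := P.minMesh_pos
  have hg := hP.gap_le k
  have hr : |x - P.node k.castSucc| ≤ (1 + M) * P.minMesh := by
    rw [abs_of_nonneg (sub_nonneg.2 hk.1)]
    rw [gap] at hg
    linarith [hk.2]
  refine (P.abs_movingAverage_envelope_sub_node_le h.antitone_slope_exp
    (h.abs_slope_exp_le hβ hP) _ hr).trans ?_
  rw [mul_assoc (2 * (√β + β) * Real.exp (√β + β))]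
  gcongr
  linarith

/-- How small the mesh has to be compared with the regularization `ε`. With `√β + β` bounding the
nodal slopes, `2 * (√β + β) * exp (√β + β)` bounds the slopes of the exponentials. The fields are
what positivity (`pos`), the curvature bound at a node (`curvature`) and the slope bound at `0` and
`1` (`endpoint`) need. -/
structure Dominated (P : UnitPartition N) (β M ε : ℝ) : Prop where
  le : P.minMesh ≤ ε
  pos : 2 * (√β + β) * Real.exp (√β + β) * (2 + M) * P.minMesh ≤ Real.exp (-(√β + β)) / 2
  curvature : (4 * (√β + β) * ((√β + β) ^ 2 * (1 + M) + (β + 2 * (√β + β) ^ 2) * (1 + M))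
      + β * M + 2 * (√β + β) ^ 3 * (1 + M) ^ 2) * P.minMesh * Real.exp (√β + β)
    ≤ β * (ε - 2 * (√β + β) * Real.exp (√β + β) * P.minMesh)
  endpoint : Real.exp (√β + β) * ((√β + β) ^ 2 * (1 + M) * P.minMesh)
    ≤ √β * (ε - 2 * (√β + β) * Real.exp (√β + β) * P.minMesh)

theorem exists_mem_Icc {x : ℝ} (P : UnitPartition N) (hx : x ∈ Icc (0 : ℝ) 1) :
    ∃ k : Fin N, x ∈ Icc (P.node k.castSucc) (P.node k.succ) := by
  rcases hx.1.eq_or_lt with h | h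
  · refine ⟨⟨0, P.pos⟩, ?_⟩
    have := P.node_castSucc_of_val_zero (i := ⟨0, P.pos⟩) rfl
    rw [← h]
    exact ⟨this.le, (P.node_mem _).1⟩
  · obtain ⟨k, hk⟩ := P.exists_mem_Ioc ⟨h, hx.2⟩
    exact ⟨k, hk.1.le, hk.2⟩

theorem Feasible.le_movingAverage (h : P.Feasible β l) (hβ : 0 ≤ β) (hP : P.Fine M (√β + β))
    {ε : ℝ} (hD : P.Dominated β M ε) {x : ℝ} (hx : x ∈ Icc (0 : ℝ) 1) :
    Real.exp (-(√β + β)) / 2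
      ≤ movingAverage (P.envelope fun k => Real.exp (l k)) P.minMesh x := by
  obtain ⟨k, hk⟩ := P.exists_mem_Icc hx
  have h1 := (abs_le.1 (h.abs_movingAverage_sub_le hβ hP hk)).1
  have h2 := h.le_exp hβ k.castSucc
  have h3 := hD.pos
  linarith

theorem Feasible.movingAverage_add_pos (h : P.Feasible β l) (hβ : 0 ≤ β)
    (hP : P.Fine M (√β + β)) {ε : ℝ} (hD : P.Dominated β M ε) {x : ℝ} (hx : x ∈ Icc (0 : ℝ) 1) :
    0 < movingAverage (P.envelope fun k => Real.exp (l k)) P.minMesh x + ε := by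
  have h1 := h.le_movingAverage hβ hP hD hx
  have h2 := Real.exp_pos (-(√β + β))
  have h3 := P.minMesh_pos.trans_le hD.le
  linarith

/-- The derivative of the logarithm of the regularized smoothing. -/
noncomputable def logSlope (P : UnitPartition N) (l : Fin (N + 1) → ℝ) (ε x : ℝ) : ℝ :=
  P.windowSlope (fun k => Real.exp (l k)) x /
    (movingAverage (P.envelope fun k => Real.exp (l k)) P.minMesh x + ε)

/-- The right derivative of `logSlope`: the smoothing has a jump of its second derivative where an
end of the window crosses a node, so that no two-sided derivative is available. -/
theorem hasDerivWithinAt_logSlope (hv : Antitone (P.slope fun k => Real.exp (l k))) {ε x : ℝ}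
    {i j : Fin N} (hi : P.InRightCell i (x - P.minMesh / 2))
    (hj : P.InRightCell j (x + P.minMesh / 2))
    (h0 : movingAverage (P.envelope fun k => Real.exp (l k)) P.minMesh x + ε ≠ 0) :
    HasDerivWithinAt (P.logSlope l ε)
      ((P.slope (fun k => Real.exp (l k)) j - P.slope (fun k => Real.exp (l k)) i) / P.minMesh
        / (movingAverage (P.envelope fun k => Real.exp (l k)) P.minMesh x + ε)
        - P.logSlope l ε x ^ 2) (Ici x) x := by
  have hs := (hasDerivAt_movingAverage (P.continuous_envelope fun k => Real.exp (l k))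
    P.minMesh x).add_const ε
  have := (P.hasDerivWithinAt_windowSlope hv hi hj).div hs.hasDerivWithinAt h0
  refine this.congr_deriv ?_
  change _ = _ - (P.windowSlope (fun k => Real.exp (l k)) x / _) ^ 2
  change (_ - _ * P.windowSlope (fun k => Real.exp (l k)) x) / _ = _
  field_simp

theorem Feasible.continuousOn_logSlope (h : P.Feasible β l) (hβ : 0 ≤ β)
    (hP : P.Fine M (√β + β)) {ε : ℝ} (hD : P.Dominated β M ε) :
    ContinuousOn (P.logSlope l ε) (Icc 0 1) := by
  refine (P.continuous_windowSlope _).continuousOn.div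
    ((contDiff_movingAverage (P.continuous_envelope _) _).continuous.add
      continuous_const).continuousOn fun x hx => (h.movingAverage_add_pos hβ hP hD hx).ne'

theorem Feasible.antitoneOn_logSlope (h : P.Feasible β l) (hβ : 0 ≤ β)
    (hP : P.Fine M (√β + β)) {ε : ℝ} (hD : P.Dominated β M ε) :
    AntitoneOn (P.logSlope l ε) (Icc 0 1) := by
  choose c hc using P.exists_inRightCell
  have hv := h.antitone_slope_exp
  have hpos : ∀ x ∈ Ico (0 : ℝ) 1,
      0 < movingAverage (P.envelope fun k => Real.exp (l k)) P.minMesh x + ε := fun x hx =>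
    h.movingAverage_add_pos hβ hP hD (Ico_subset_Icc_self hx)
  refine antitoneOn_of_deriv_right_nonpos (h.continuousOn_logSlope hβ hP hD)
    (fun x hx => hasDerivWithinAt_logSlope hv (hc _) (hc _) (hpos x hx).ne') fun x hx => ?_
  have h1 := P.windowSlope_mem hv (hc (x - P.minMesh / 2)) (hc (x + P.minMesh / 2))
  have h2 := div_nonpos_of_nonpos_of_nonneg (div_nonpos_of_nonpos_of_nonneg
    (sub_nonpos.2 (h1.1.trans h1.2)) P.minMesh_pos.le) (hpos x hx).le
  linarith [sq_nonneg (P.logSlope l ε x)]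

/-- At the ends of `[0,1]` the nodal slopes are at most `√β` in absolute value, and the
regularization absorbs the discretization error; monotonicity does the rest. -/
theorem Feasible.abs_logSlope_le (h : P.Feasible β l) (hβ : 0 ≤ β)
    (hP : P.Fine M (√β + β)) {ε : ℝ} (hD : P.Dominated β M ε) {x : ℝ} (hx : x ∈ Icc (0 : ℝ) 1) :
    |P.logSlope l ε x| ≤ √β := by
  have hv := h.antitone_slope_exp
  have hd := P.minMesh_pos
  have hε := hd.trans_le hD.le
  have hM := hP.nonneg
  have hend := hD.endpoint
  set B := √β + β with hB
  have hB0 : 0 ≤ B := by positivity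
  have hL := h.abs_slope_exp_le hβ hP
  have hpos : ∀ x ∈ Icc (0 : ℝ) 1,
      0 < movingAverage (P.envelope fun k => Real.exp (l k)) P.minMesh x + ε := fun x hx =>
    h.movingAverage_add_pos hβ hP hD hx
  have hm := h.antitoneOn_logSlope hβ hP hD
  have herr : ∀ (i : Fin N) (k : Fin (N + 1)), Real.exp (l k) * (B ^ 2 * P.gap i)
      ≤ Real.exp B * (B ^ 2 * (1 + M) * P.minMesh) := by
    intro i k
    rw [mul_assoc (B ^ 2)]
    have := P.gap_pos i
    gcongr
    · exact (abs_le.1 (h.abs_node_le hβ _)).2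
    · exact hP.gap_le i
  have hs : ∀ k : Fin (N + 1), Real.exp (l k) - 2 * B * Real.exp B * P.minMesh
      ≤ movingAverage (P.envelope fun k => Real.exp (l k)) P.minMesh (P.node k) := by
    intro k
    have h1 := (abs_le.1 (P.abs_movingAverage_envelope_sub_node_le hv hL (x := P.node k) (r := 0) k
      (by simp))).1
    have h2 : 0 ≤ 2 * B * Real.exp B * P.minMesh := by positivity
    linarith
  have hmul : ∀ k : Fin (N + 1), √β * (Real.exp (l k) - 2 * B * Real.exp B * P.minMesh + ε)
      ≤ √β * (movingAverage (P.envelope fun k => Real.exp (l k)) P.minMesh (P.node k) + ε) := by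
    intro k
    have := hs k
    gcongr
  rw [abs_le]
  constructor
  · refine le_trans ?_ (hm hx (right_mem_Icc.2 zero_le_one) hx.2)
    let n : Fin N := ⟨N - 1, Nat.sub_one_lt P.pos.ne'⟩
    have hn : (n : ℕ) + 1 = N := Nat.sub_one_add_one P.pos.ne'
    obtain ⟨i, hi⟩ := P.exists_inRightCell (1 - P.minMesh / 2)
    obtain ⟨j, hj⟩ := P.exists_inRightCell (1 + P.minMesh / 2)
    have h1 := (P.windowSlope_mem hv hi hj).1
    have h2 : P.slope (fun k => Real.exp (l k)) n ≤ P.slope (fun k => Real.exp (l k)) j :=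
      hv (by rw [Fin.le_def]; have := j.isLt; omega)
    have h3 := (abs_le.1 (h.slope_exp_right hβ hP n).1).1
    have h4 := herr n n.succ
    have h5 := (abs_le.1 (Real.abs_le_sqrt (sub_nonpos.1 (h.right_end n hn)))).1
    have h6 := mul_le_mul_of_nonneg_left h5 (Real.exp_pos (l n.succ)).le
    have h7 := hmul n.succ
    rw [P.node_succ_of_val_last hn] at h7
    rw [logSlope, le_div_iff₀ (hpos 1 (right_mem_Icc.2 zero_le_one))]
    linarith
  · refine (hm (left_mem_Icc.2 zero_le_one) hx hx.1).trans ?_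
    let n : Fin N := ⟨0, P.pos⟩
    obtain ⟨i, hi⟩ := P.exists_inRightCell (0 - P.minMesh / 2)
    obtain ⟨j, hj⟩ := P.exists_inRightCell (0 + P.minMesh / 2)
    have h1 := (P.windowSlope_mem hv hi hj).2
    have h2 : P.slope (fun k => Real.exp (l k)) i ≤ P.slope (fun k => Real.exp (l k)) n :=
      hv (by rw [Fin.le_def]; exact Nat.zero_le _)
    have h3 := (abs_le.1 (h.slope_exp_left hβ hP n).1).2
    have h4 := herr n n.castSucc
    have h5 := (abs_le.1 (Real.abs_le_sqrt (sub_nonpos.1 (h.left_end n rfl)))).2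
    have h6 := mul_le_mul_of_nonneg_left h5 (Real.exp_pos (l n.castSucc)).le
    have h7 := hmul n.castSucc
    rw [P.node_castSucc_of_val_zero (i := n) rfl] at h7
    rw [logSlope, div_le_iff₀ (hpos 0 (left_mem_Icc.2 zero_le_one))]
    linarith

/-- The right derivative of `logSlope` lies in `[-β, 0]`: if the window contains no node this is the
bound on `logSlope` itself, and otherwise it is `curvature_lower_bound`. -/
theorem Feasible.lipschitz_logSlope (h : P.Feasible β l) (hβ : 0 < β)
    (hP : P.Fine M (√β + β)) {ε : ℝ} (hD : P.Dominated β M ε) {x y : ℝ}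
    (hx : x ∈ Icc (0 : ℝ) 1) (hy : y ∈ Icc (0 : ℝ) 1) :
    |P.logSlope l ε x - P.logSlope l ε y| ≤ β * |x - y| := by
  choose c hc using P.exists_inRightCell
  have hv := h.antitone_slope_exp
  have hd := P.minMesh_pos
  have hε := hd.trans_le hD.le
  have hM := hP.nonneg
  have hpos : ∀ x ∈ Ico (0 : ℝ) 1,
      0 < movingAverage (P.envelope fun k => Real.exp (l k)) P.minMesh x + ε := fun x hx =>
    h.movingAverage_add_pos hβ.le hP hD (Ico_subset_Icc_self hx)
  refine abs_sub_le_of_deriv_right (h.continuousOn_logSlope hβ.le hP hD)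
    (fun x hx => hasDerivWithinAt_logSlope hv (hc _) (hc _) (hpos x hx).ne') (fun x hx => ?_) hx hy
  have hi := hc (x - P.minMesh / 2)
  have hj := hc (x + P.minMesh / 2)
  generalize c (x - P.minMesh / 2) = i at hi
  generalize c (x + P.minMesh / 2) = j at hj
  have hp0 := hpos x hx
  have hmem := P.windowSlope_mem hv hi hj
  rw [abs_le]
  refine ⟨?_, ?_⟩
  · rcases P.cells_of_window hi hj with rfl | ⟨hij, hnode⟩
    · rw [sub_self, zero_div, zero_div, zero_sub, neg_le_neg_iff]
      have h1 := h.abs_logSlope_le hβ.le hP hD (Ico_subset_Icc_self hx)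
      calc P.logSlope l ε x ^ 2 = |P.logSlope l ε x| ^ 2 := (sq_abs _).symm
        _ ≤ √β ^ 2 := by gcongr
        _ = β := Real.sq_sqrt hβ.le
    · have hcs := castSucc_eq_succ hij
      have hE := Real.exp_pos (l i.succ)
      have hEB := h.exp_le hβ.le i.succ
      have hL := h.abs_slope_exp_le hβ.le hP
      have hcurv := hD.curvature
      have hri := h.slope_exp_right hβ.le hP i
      have hlj := h.slope_exp_left hβ.le hP j
      have hsm := h.smooth i j hij
      have hsi := h.abs_slope_le hβ.le i
      have hsj := h.abs_slope_le hβ.le j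
      have hmul := hP.mul_le
      rw [hcs] at hlj
      set B := √β + β with hB
      have hB0 : 0 ≤ B := by positivity
      have hs := (abs_le.1 (P.abs_movingAverage_envelope_sub_node_le hv hL (x := x)
        (r := P.minMesh / 2) i.succ
        (by rw [abs_le]; constructor <;> linarith [hnode.1, hnode.2]))).1
      set s := movingAverage (P.envelope fun k => Real.exp (l k)) P.minMesh x with hsdef
      set E := Real.exp (l i.succ) with hEdef
      set C := 4 * B * (B ^ 2 * (1 + M) + (β + 2 * B ^ 2) * (1 + M)) + β * M
        + 2 * B ^ 3 * (1 + M) ^ 2 with hC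
      have hC0 : 0 ≤ C * P.minMesh := by positivity
      have hq : C * P.minMesh ≤ β * ((s + ε) / E - 1) := by
        have e : β * ((s + ε) / E - 1) = β * (s + ε - E) / E := by field_simp
        rw [e, le_div_iff₀ hE]
        have h1 : C * P.minMesh * E ≤ C * P.minMesh * Real.exp B := by gcongr
        have h2 : β * (ε - 2 * B * Real.exp B * P.minMesh) ≤ β * (s + ε - E) :=
          mul_le_mul_of_nonneg_left (by linarith) hβ.le
        linarith
      have hq1 : 1 ≤ (s + ε) / E := by
        have : 0 ≤ (s + ε) / E - 1 := nonneg_of_mul_nonneg_right (hC0.trans hq) hβ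
        linarith
      have habs : ∀ a b c : ℝ, |a - E * b| ≤ E * c → |a / E - b| ≤ c := by
        intro a b c hab
        have e : a / E - b = (a - E * b) / E := by field_simp
        rw [e, abs_div, abs_of_pos hE, div_le_iff₀ hE, mul_comm c]
        exact hab
      have key := curvature_lower_bound (β := β) (B := B) (m := 1 + M) (M := M) (d := P.minMesh)
        (fi := P.slope (fun k => Real.exp (l k)) i / E)
        (fj := P.slope (fun k => Real.exp (l k)) j / E)
        (p := P.windowSlope (fun k => Real.exp (l k)) x / E) (q := (s + ε) / E)
        hβ.le hB0 hM (by positivity) hd hP.le_one hmul (P.minMesh_le_gap i) (P.minMesh_le_gap j)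
        (hP.gap_le i) (hP.gap_le j) (hP.gap_le_add_cube i)
        (hP.gap_le_add_cube j) hsi hsj (by rw [gap, gap, hcs]; linarith)
        (by rw [le_div_iff₀ hE]; linarith [hlj.2]) (habs _ _ _ hlj.1)
        (by rw [div_le_iff₀ hE]; linarith [hri.2]) (habs _ _ _ hri.1)
        ⟨by gcongr; exact hmem.1, by gcongr; exact hmem.2⟩ hq1 hq
      refine key.trans_eq ?_
      rw [logSlope, ← hsdef]
      field_simp
  · have h2 := div_nonpos_of_nonpos_of_nonneg (div_nonpos_of_nonpos_of_nonneg
      (sub_nonpos.2 (hmem.1.trans hmem.2)) hd.le) hp0.le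
    linarith [sq_nonneg (P.logSlope l ε x)]

/-- All errors are of the order of the mesh, except the one made by adding `ε`; as the mesh is at
most `ε`, the constant involves neither. -/
theorem Feasible.abs_logSlope_sub_slope_le (h : P.Feasible β l) (hβ : 0 ≤ β)
    (hP : P.Fine M (√β + β)) {ε : ℝ} (hD : P.Dominated β M ε) {x : ℝ} {k : Fin N}
    (hx : x ∈ Icc (0 : ℝ) 1) (hk : x ∈ Icc (P.node k.castSucc) (P.node k.succ)) :
    |P.logSlope l ε x - P.slope l k| ≤
      2 * Real.exp (√β + β) * (Real.exp (√β + β) * ((β + 2 * (√β + β) ^ 2) * (1 + M))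
        + Real.exp (√β + β) * ((√β + β) ^ 2 * (1 + M))
        + (√β + β) * (2 * (√β + β) * Real.exp (√β + β) * (2 + M)) + (√β + β)) * ε := by
  have hv := h.antitone_slope_exp
  have hd := P.minMesh_pos
  have hM := hP.nonneg
  have hdε := hD.le
  have hε := hd.trans_le hD.le
  have hlow := h.le_movingAverage hβ hP hD hx
  have hclose := h.abs_movingAverage_sub_le hβ hP hk
  have hF := (h.slope_exp_left hβ hP k).1
  have hsk := h.abs_slope_le hβ k
  have hE := h.exp_le hβ k.castSucc
  have hgap := hP.gap_le k
  have hgap0 := P.gap_pos k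
  have hwin : |P.windowSlope (fun k => Real.exp (l k)) x - P.slope (fun k => Real.exp (l k)) k|
      ≤ Real.exp (√β + β) * ((β + 2 * (√β + β) ^ 2) * (1 + M) * P.minMesh) := by
    obtain ⟨i, hi⟩ := P.exists_inRightCell (x - P.minMesh / 2)
    obtain ⟨j, hj⟩ := P.exists_inRightCell (x + P.minMesh / 2)
    obtain ⟨hik, hkj⟩ := P.le_le_of_mem_Icc hi hj hk
    have h1 := P.windowSlope_mem hv hi hj
    have h2 := hv hik
    have h3 := hv hkj
    have h4 : P.slope (fun k => Real.exp (l k)) i - P.slope (fun k => Real.exp (l k)) j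
        ≤ Real.exp (√β + β) * ((β + 2 * (√β + β) ^ 2) * (1 + M) * P.minMesh) := by
      rcases P.cells_of_window hi hj with rfl | ⟨hij, -⟩
      · rw [sub_self]; positivity
      · exact h.slope_exp_sub_le hβ hP hij
    rw [abs_le]
    constructor <;> linarith [h1.1, h1.2]
  set B := √β + β with hB
  have hB0 : 0 ≤ B := by positivity
  rw [logSlope]
  set s := movingAverage (P.envelope fun k => Real.exp (l k)) P.minMesh x
  set w := P.windowSlope (fun k => Real.exp (l k)) x
  set F := P.slope (fun k => Real.exp (l k)) k
  set E := Real.exp (l k.castSucc)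
  set S := P.slope l k
  have hs0 : 0 < s + ε := by have := Real.exp_pos (-B); linarith
  have h1 : Real.exp B * ((β + 2 * B ^ 2) * (1 + M) * P.minMesh)
      ≤ Real.exp B * ((β + 2 * B ^ 2) * (1 + M)) * ε := by
    rw [← mul_assoc]; gcongr
  have h2 : E * (B ^ 2 * P.gap k) ≤ Real.exp B * (B ^ 2 * (1 + M)) * ε := by
    calc E * (B ^ 2 * P.gap k) ≤ Real.exp B * (B ^ 2 * ((1 + M) * ε)) := by
          gcongr
          exact hgap.trans (by gcongr)
      _ = _ := by ring
  have h3 : |S * (E - s)| ≤ B * (2 * B * Real.exp B * (2 + M)) * ε := by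
    rw [abs_mul, mul_assoc B]
    gcongr
    rw [abs_sub_comm]
    exact hclose.trans (by gcongr)
  have h4 : |S * ε| ≤ B * ε := by
    rw [abs_mul, abs_of_pos hε]; gcongr
  have h5 : |w - S * (s + ε)| ≤ (Real.exp B * ((β + 2 * B ^ 2) * (1 + M))
      + Real.exp B * (B ^ 2 * (1 + M)) + B * (2 * B * Real.exp B * (2 + M)) + B) * ε := by
    rw [abs_le] at *
    constructor <;> linarith [hwin.1, hwin.2, hF.1, hF.2, h3.1, h3.2, h4.1, h4.2]
  set K := Real.exp B * ((β + 2 * B ^ 2) * (1 + M))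
      + Real.exp B * (B ^ 2 * (1 + M)) + B * (2 * B * Real.exp B * (2 + M)) + B
  have hK : 0 ≤ K := by positivity
  have e : w / (s + ε) - S = (w - S * (s + ε)) / (s + ε) := by field_simp
  rw [e, abs_div, abs_of_pos hs0, div_le_iff₀ hs0]
  refine h5.trans ?_
  have h6 : 1 ≤ 2 * Real.exp B * (s + ε) := by
    have h7 : 2 * Real.exp B * (Real.exp (-B) / 2) = 1 := by
      have : Real.exp B * Real.exp (-B) = 1 := by rw [← Real.exp_add]; simp
      linarith
    rw [← h7]
    gcongr
    linarith
  calc K * ε = 1 * (K * ε) := (one_mul _).symm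
    _ ≤ (2 * Real.exp B * (s + ε)) * (K * ε) := by gcongr
    _ = _ := by ring

/-! ### Passage to the regularized logarithm -/

theorem Feasible.hasDerivWithinAt_logSmoothing (h : P.Feasible β l) (hβ : 0 ≤ β)
    (hP : P.Fine M (√β + β)) {α : ℝ} (hD : P.Dominated β M (P.minMesh ^ α)) {x : ℝ}
    (hx : x ∈ Icc (0 : ℝ) 1) :
    HasDerivWithinAt (P.logSmoothing α l) (P.logSlope l (P.minMesh ^ α) x) (Icc 0 1) x := by
  have hv := h.antitone_slope_exp
  have hpos := (h.movingAverage_add_pos hβ hP hD hx).ne'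
  have hs := ((hasDerivAt_movingAverage (P.continuous_envelope fun k => Real.exp (l k))
    P.minMesh x).add_const (P.minMesh ^ α)).log hpos
  refine (hs.sub_const (Real.log (P.smoothing l (1 / 2) + P.minMesh ^ α))).hasDerivWithinAt.congr
    (fun y hy => ?_) ?_
  · rw [logSmoothing, P.smoothing_eq_movingAverage l hv hy]
  · rw [logSmoothing, P.smoothing_eq_movingAverage l hv hx]

theorem contDiffOn_smoothing (hv : Antitone (P.slope fun k => Real.exp (l k))) :
    ContDiffOn ℝ 1 (P.smoothing l) (Icc 0 1) :=
  (contDiff_movingAverage (P.continuous_envelope _) _).contDiffOn.congr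
    fun _ hx => P.smoothing_eq_movingAverage l hv hx

theorem Feasible.smoothing_pos (h : P.Feasible β l) (hβ : 0 ≤ β) (hP : P.Fine M (√β + β))
    {ε : ℝ} (hD : P.Dominated β M ε) {x : ℝ} (hx : x ∈ Icc (0 : ℝ) 1) : 0 < P.smoothing l x := by
  rw [P.smoothing_eq_movingAverage l h.antitone_slope_exp hx]
  have h1 := h.le_movingAverage hβ hP hD hx
  have h2 := Real.exp_pos (-(√β + β))
  linarith

theorem Feasible.logSmoothing_mem (h : P.Feasible β l) (hβ : 0 < β)
    (hP : P.Fine M (√β + β)) {α : ℝ} (hD : P.Dominated β M (P.minMesh ^ α)) :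
    P.logSmoothing α l ∈ GenFunSmooth β := by
  have hv := h.antitone_slope_exp
  have hε := P.minMesh_pos.trans_le hD.le
  have hpos : ∀ x ∈ Icc (0 : ℝ) 1, 0 < P.smoothing l x + P.minMesh ^ α := fun x hx =>
    add_pos (h.smoothing_pos hβ.le hP hD hx) hε
  have hhalf := hpos (1 / 2) (by norm_num)
  refine ⟨⟨?_, ?_, ?_⟩, fun x hx y hy => ?_⟩
  · exact (((contDiffOn_smoothing hv).add contDiffOn_const).log fun x hx => (hpos x hx).ne').sub
      contDiffOn_const
  · have hc := ((P.concaveOn_movingAverage_envelope hv).add_const (P.minMesh ^ α)).smul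
      (inv_nonneg.2 hhalf.le)
    refine hc.congr fun x hx => ?_
    simp only [logSmoothing, Pi.add_apply, smul_eq_mul]
    rw [Real.exp_sub, Real.exp_log (hpos x hx), Real.exp_log hhalf,
      P.smoothing_eq_movingAverage l hv hx]
    ring
  · rw [logSmoothing, sub_self]
  · have hu := uniqueDiffOn_Icc (zero_lt_one (α := ℝ))
    rw [(h.hasDerivWithinAt_logSmoothing hβ.le hP hD hx).derivWithin (hu x hx),
      (h.hasDerivWithinAt_logSmoothing hβ.le hP hD hy).derivWithin (hu y hy)]
    exact h.lipschitz_logSlope hβ hP hD hx hy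

/-- All smallness requirements follow once a single large multiple of the mesh is at most `ε`. -/
theorem exists_forall_fine_dominated (hβ : 0 < β) (hM : 0 ≤ M) :
    ∃ A : ℝ, ∀ (N : ℕ) (P : UnitPartition N), |P.mesh - P.minMesh| ≤ M * P.minMesh ^ 3 →
      P.minMesh ≤ 1 → ∀ ε ≤ 1, A * P.minMesh ≤ ε →
      P.Fine M (√β + β) ∧ P.Dominated β M ε := by
  set B := √β + β with hB
  have hB0 : 0 ≤ B := by positivity
  have hβ' : 0 < √β := Real.sqrt_pos.2 hβ
  -- One summand for each requirement: each is the coefficient of the mesh after solving for `ε`.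
  set a1 := B * (1 + M) with ha1
  set a2 := 2 * Real.exp B * (2 * B * Real.exp B * (2 + M)) with ha2
  set C := 4 * B * (B ^ 2 * (1 + M) + (β + 2 * B ^ 2) * (1 + M)) + β * M
    + 2 * B ^ 3 * (1 + M) ^ 2 with hC
  set a3 := C * Real.exp B / β + 2 * B * Real.exp B with ha3
  set a4 := Real.exp B * (B ^ 2 * (1 + M)) / √β + 2 * B * Real.exp B with ha4
  refine ⟨1 + a1 + a2 + a3 + a4, fun N P hmesh hd1 ε hε hA => ?_⟩
  have hd := P.minMesh_pos
  have n1 : 0 ≤ a1 * P.minMesh := by positivity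
  have n2 : 0 ≤ a2 * P.minMesh := by positivity
  have n3 : 0 ≤ a3 * P.minMesh := by positivity
  have n4 : 0 ≤ a4 * P.minMesh := by positivity
  have hsum : P.minMesh + a1 * P.minMesh + a2 * P.minMesh + a3 * P.minMesh + a4 * P.minMesh ≤ ε := by
    linarith
  refine ⟨⟨hM, hmesh, hd1, ?_⟩, ⟨by linarith, ?_, ?_, ?_⟩⟩
  · rw [← mul_assoc]; linarith
  · have h1 : a2 * P.minMesh ≤ 1 := by linarith
    have h2 : Real.exp B * Real.exp (-B) = 1 := by rw [← Real.exp_add]; simp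
    have h3 : 2 * B * Real.exp B * (2 + M) * P.minMesh
        = (a2 * P.minMesh) * (Real.exp (-B) / 2) := by
      rw [ha2]
      linear_combination (-(2 * B * Real.exp B * (2 + M) * P.minMesh)) * h2
    rw [← hB, h3]
    exact mul_le_of_le_one_left (by positivity) h1
  · have h1 : β * (a3 * P.minMesh) ≤ β * ε := by
      gcongr
      linarith
    have h2 : β * (a3 * P.minMesh) = C * P.minMesh * Real.exp B
        + β * (2 * B * Real.exp B * P.minMesh) := by
      rw [ha3]; field_simp
    linarith
  · have h1 : √β * (a4 * P.minMesh) ≤ √β * ε := by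
      gcongr
      linarith
    have h2 : √β * (a4 * P.minMesh) = Real.exp B * (B ^ 2 * (1 + M) * P.minMesh)
        + √β * (2 * B * Real.exp B * P.minMesh) := by
      rw [ha4]; field_simp
    linarith

end UnitPartition

theorem proposition4 (β M : ℝ) (hβ : 0 < β) (hM : 0 < M) :
    ∃ K : ℝ, 0 < K ∧ ∀ α : ℝ, 0 < α → α < 1 →
      ∃ δ₀ : ℝ, 0 < δ₀ ∧ ∀ (N : ℕ) (P : UnitPartition N),
        |P.mesh - P.minMesh| ≤ M * P.minMesh ^ 3 → P.minMesh < δ₀ →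
        ∀ l : Fin (N + 1) → ℝ, P.Feasible β l →
          ContDiffOn ℝ 1 (P.smoothing l) (Icc 0 1) ∧
          (∀ x ∈ Icc (0 : ℝ) 1, 0 < P.smoothing l x) ∧
          P.logSmoothing α l ∈ GenFunSmooth β ∧
          (∀ x ∈ Ico (0 : ℝ) 1,
            |derivWithin (P.logSmoothing α l) (Icc 0 1) x
                - derivWithin (P.interp l) (Ici x) x| ≤ K * P.minMesh ^ α) ∧
          (∀ x ∈ Ioc (0 : ℝ) 1,
            |derivWithin (P.logSmoothing α l) (Icc 0 1) x
                - derivWithin (P.interp l) (Iic x) x| ≤ K * P.minMesh ^ α) ∧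
          K * P.minMesh ^ α ≤ K * P.mesh ^ α := by
  obtain ⟨A, hA⟩ := UnitPartition.exists_forall_fine_dominated hβ hM.le
  have hu := uniqueDiffOn_Icc (zero_lt_one (α := ℝ))
  refine ⟨2 * Real.exp (√β + β) * (Real.exp (√β + β) * ((β + 2 * (√β + β) ^ 2) * (1 + M))
    + Real.exp (√β + β) * ((√β + β) ^ 2 * (1 + M))
    + (√β + β) * (2 * (√β + β) * Real.exp (√β + β) * (2 + M)) + (√β + β)), by positivity,
    fun α hα0 hα1 => ?_⟩
  obtain ⟨d₀, hd₀, hsmall⟩ := exists_forall_mul_le_rpow A hα1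
  refine ⟨min 1 d₀, lt_min one_pos hd₀, fun N P hmesh hlt l h => ?_⟩
  have hd := P.minMesh_pos
  have hd1 : P.minMesh ≤ 1 := (hlt.trans_le (min_le_left _ _)).le
  obtain ⟨hP, hD⟩ := hA N P hmesh hd1 (P.minMesh ^ α) (Real.rpow_le_one hd.le hd1 hα0.le)
    (hsmall _ hd (hlt.trans_le (min_le_right _ _)))
  refine ⟨UnitPartition.contDiffOn_smoothing h.antitone_slope_exp,
    fun x hx => h.smoothing_pos hβ.le hP hD hx, h.logSmoothing_mem hβ hP hD,
    fun x hx => ?_, fun x hx => ?_, ?_⟩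
  · have hx' := Ico_subset_Icc_self hx
    obtain ⟨k, hk, e⟩ := P.derivWithin_interp_Ici l hx
    rw [e, (h.hasDerivWithinAt_logSmoothing hβ.le hP hD hx').derivWithin (hu x hx')]
    exact h.abs_logSlope_sub_slope_le hβ.le hP hD hx' hk
  · have hx' := Ioc_subset_Icc_self hx
    obtain ⟨k, hk, e⟩ := P.derivWithin_interp_Iic l hx
    rw [e, (h.hasDerivWithinAt_logSmoothing hβ.le hP hD hx').derivWithin (hu x hx')]
    exact h.abs_logSlope_sub_slope_le hβ.le hP hD hx' hk
  · have := P.minMesh_le_mesh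
    gcongr
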